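/- \textbf{Setting.} Let $p,q\ge 0$, and let $B\subset\mathbb R^{p+q}$ be open, with elements written $\beta=(\theta,\gamma)$, $\theta\in\mathbb R^p$, $\gamma\in\mathbb R^q$. For each observation index $i$ let $\{f_i(\cdot,\beta):\beta\in B\}$ be a family of probability densities with respect to a $\sigma$-finite measure, whose support does not depend on $\beta$ (i.i.d. data: $f_i=f$). The observations $y_1,y_2,\dots$ are independent and $y_i$ has density $f_i(\cdot,\beta_{\rm true})$, where $\beta_{\rm true}=(\theta_{\rm true},\gamma_{\rm true})\in B$; $\mathbb E$ and $\mathbb P$ refer to this law. Let $\mathcal M$ be a nonempty set of candidate models. A model $k\in\mathcal M$ is given by a subset of $m_k$ of the $q$ components of $\gamma$; its parameter is $\beta_k=(\theta,\gamma_k)\in\mathbb R^{p+m_k}$, the $q-m_k$ missing components of $\gamma$ being set equal to fixed real numbers $c_k$. Write $\widetilde\beta_k\in\mathbb R^{p+q}$ for the parameter so augmented, $B_k=\{\beta_k:\widetilde\beta_k\in B\}$, $\ell_{k;i}(\beta_k)=\log f_i(y_i,\widetilde\beta_k)$ and $\ell_k=\sum_{i=1}^n\ell_{k;i}$; primes denote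 derivatives in $\beta_k$. Let $\widehat\beta_k=(\widehat\theta_k,\widehat\gamma_k)$ be the maximum likelihood estimator of model $k$, that is, a measurable estimator which maximizes $\ell_k$ over $B_k$ with probability tending to one as $n\to\infty$. Let $w_k$ ($k\in\mathcal M$) be fixed weights with $0\le w_k\le1$ and $\sum_kw_k=1$. \textbf{Regularity conditions.} For every $k\in\mathcal M$ there is $\beta_k^*=(\theta_k^*,\gamma_k^*)\in B_k$ such that: \begin{enumerate} \item $\mathbb E[\ell'_{k;i}(\beta_k^*)]=0$ for all $i$, each $\ell'_{k;i}(\beta_k^*)$ is square integrable, and $\frac1n\sum_{i=1}^n\mathbb E\|\ell'_{k;i}(\beta_k^*)\|^2$ is bounded in $n$; \item almost surely $\ell'_{k;i}$ and $\ell''_{k;i}$ exist on a ball around $\beta_k^*$ whose radius does not depend on $i$; \item $\ell''_{k;i}$ is continuous at $\beta_k^*$, uniformly on average: for each $\eta>0$ there are $r>0$ and integrable $G_i(y_i)$ that bound all entries of $|\ell''_{k;i}(t)-\ell''_{k;i}(\beta_k^*)|$ for all $\|t-\beta_k^*\|<r$, with $\frac1n\sum_{i=1}^n\mathbb E\,G_i(y_i)\le\eta$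 for all large $n$; \item there are $r,\delta>0$, $K$ and $D_i$ such that almost surely the entries of $|\ell''_{k;i}(t)|$ are at most $D_i(y_i)$ for all $\|t-\beta_k^*\|<r$, and $\mathbb E|D_i(y_i)|^{1+\delta}\le K$ for all $i$; \item $\mathbf H_k=\lim_n\frac1n\mathbb E[\ell_k''(\beta_k^*)]$ exists, with $\ell''_{k;i}(\beta_k^*)$ integrable, and $\mathbf H_k$ is invertible; \item (identifiability) for every $\varepsilon>0$ there is $\eta>0$ such that, with probability tending to one, $\frac1n\{\ell_k(\beta)-\ell_k(\beta_k^*)\}\le-\eta$ for all $\beta\in B_k$ with $\|\beta-\beta_k^*\|\ge\varepsilon$. \end{enumerate} Moreover, with $U_i=\max_{k\in\mathcal M}\big\|[\mathbf I_p,\mathbf 0]\,\mathbf H_k^{-1}\ell'_{k;i}(\beta_k^*)\big\|$, $$\textbf{(A1)}\qquad \lim_{n\to\infty}\frac1n\sum_{i=1}^n\mathbb E\big[U_i^2\,\mathbb I\{U_i>\sqrt n\,\varepsilon\}\big]=0\quad\text{for every }\varepsilon>0 .$$ \textbf{Corollary.} Suppose in addition that the limit $$\Sigma_w=\lim_{n\to\infty}\frac1n\sum_{i=1}^n\mathbb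 E\Big[\Big(\sum_{k\in\mathcal M}w_k[\mathbf I_p,\mathbf 0]\,\mathbf H_k^{-1}\ell'_{k;i}(\beta_k^*)\Big)^{\otimes2}\Big]$$ exists, where $v^{\otimes 2}=vv^\top$. Then $\Sigma_w$ is positive semidefinite and, as $n\to\infty$, $$\sqrt n\sum_{k\in\mathcal M}w_k(\widehat\theta_k-\theta_{\rm true})-\sqrt n\sum_{k\in\mathcal M}w_k(\theta_k^*-\theta_{\rm true})\ \xrightarrow{\ d\ }\ \mathcal N(0,\Sigma_w).$$ -/

import Mathlib

open MeasureTheory ProbabilityTheory Filter Topology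

noncomputable section

namespace ModelAveraging

/-- Full parameter vectors `β = (θ, γ) ∈ ℝ^(p+q)`; `Sum.inl` indexes `θ`, `Sum.inr` indexes `γ`. -/
abbrev FullParam (p q : ℕ) : Type := EuclideanSpace ℝ (Fin p ⊕ Fin q)

/-- Parameter vectors `β_k = (θ, γ_k) ∈ ℝ^(p+m_k)` of the candidate model that contains `θ` and the
components of `γ` whose index lies in the set `k`; here `m_k` is the cardinality of `k`. -/
abbrev SubParam (p : ℕ) {q : ℕ} (k : Finset (Fin q)) : Type := EuclideanSpace ℝ (Fin p ⊕ k)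

/-- The common part: `(θ, γ) ↦ θ`. -/
def thetaPart {p : ℕ} {κ : Type*} (b : EuclideanSpace ℝ (Fin p ⊕ κ)) : EuclideanSpace ℝ (Fin p) :=
  WithLp.toLp 2 fun j => b (Sum.inl j)

/-- The `c`-augmentation of a parameter of the candidate model `k`: the missing components of `γ`
are filled with the fixed values `c`. -/
def augment {p q : ℕ} {k : Finset (Fin q)} (c : Fin q → ℝ) (b : SubParam p k) : FullParam p q :=
  WithLp.toLp 2 (Sum.elim (fun j => b (Sum.inl j))
    (fun j => if h : j ∈ k then b (Sum.inr ⟨j, h⟩) else c j))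

/-- The parameter space of the candidate model `k` inside the parameter space `B` of the family. -/
def subSpace {p q : ℕ} (B : Set (FullParam p q)) (k : Finset (Fin q)) (c : Fin q → ℝ) :
    Set (SubParam p k) :=
  {b | augment c b ∈ B}

/-- `f i y β` is, for each observation index `i` and each `β` in the open parameter space `B`, a
probability density in `y` with respect to `ν`, whose support does not depend on `β`. -/
structure IsDensityFamily {𝒴 : Type*} [MeasurableSpace 𝒴] {p q : ℕ} (ν : Measure 𝒴)
    (f : ℕ → 𝒴 → FullParam p q → ℝ) (B : Set (FullParam p q)) : Prop where
  isOpen : IsOpen B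
  measurable : ∀ i, ∀ b ∈ B, Measurable fun y => f i y b
  nonneg : ∀ i, ∀ b ∈ B, ∀ y, 0 ≤ f i y b
  lintegral_eq_one : ∀ i, ∀ b ∈ B, ∫⁻ y, ENNReal.ofReal (f i y b) ∂ν = 1
  support_eq : ∀ i, ∀ b ∈ B, ∀ b' ∈ B, ∀ y, f i y b = 0 ↔ f i y b' = 0

/-- The law of the `i`-th observation under the parameter `β`. -/
def obsLaw {𝒴 : Type*} [MeasurableSpace 𝒴] {p q : ℕ} (ν : Measure 𝒴)
    (f : ℕ → 𝒴 → FullParam p q → ℝ) (β : FullParam p q) (i : ℕ) : Measure 𝒴 :=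
  ν.withDensity fun y => ENNReal.ofReal (f i y β)

/-- `ℓ_{k;i}`: the log-likelihood of one observation `y` with index `i` in the candidate model
`k`. -/
def logLik {𝒴 : Type*} {p q : ℕ} (f : ℕ → 𝒴 → FullParam p q → ℝ) (k : Finset (Fin q))
    (c : Fin q → ℝ) (i : ℕ) (y : 𝒴) (b : SubParam p k) : ℝ :=
  Real.log (f i y (augment c b))

/-- `ℓ_k`: the log-likelihood of the first `n` observations in the candidate model `k`. -/
def sampleLogLik {𝒴 : Type*} {p q : ℕ} (f : ℕ → 𝒴 → FullParam p q → ℝ) (k : Finset (Fin q))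
    (c : Fin q → ℝ) (n : ℕ) (y : ℕ → 𝒴) (b : SubParam p k) : ℝ :=
  ∑ i ∈ Finset.range n, logLik f k c i (y i) b

/-- `b` is a maximum likelihood estimate in the candidate model `k` from the first `n`
observations. -/
def IsMLE {𝒴 : Type*} {p q : ℕ} (f : ℕ → 𝒴 → FullParam p q → ℝ) (B : Set (FullParam p q))
    (k : Finset (Fin q)) (c : Fin q → ℝ) (n : ℕ) (y : ℕ → 𝒴) (b : SubParam p k) : Prop :=
  b ∈ subSpace B k c ∧
    ∀ b' ∈ subSpace B k c, sampleLogLik f k c n y b' ≤ sampleLogLik f k c n y b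

/-- `ℓ'_{k;i}`: the score of one observation. -/
def score {𝒴 : Type*} {p q : ℕ} (f : ℕ → 𝒴 → FullParam p q → ℝ) (k : Finset (Fin q))
    (c : Fin q → ℝ) (i : ℕ) (y : 𝒴) (b : SubParam p k) : SubParam p k :=
  gradient (logLik f k c i y) b

/-- `ℓ''_{k;i}`: the matrix of second partial derivatives of the log-likelihood of one
observation. -/
def scoreDeriv {𝒴 : Type*} {p q : ℕ} (f : ℕ → 𝒴 → FullParam p q → ℝ) (k : Finset (Fin q))
    (c : Fin q → ℝ) (i : ℕ) (y : 𝒴) (b : SubParam p k) :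
    Matrix (Fin p ⊕ k) (Fin p ⊕ k) ℝ :=
  Matrix.of fun a a' => fderiv ℝ (score f k c i y) b (EuclideanSpace.single a' 1) a

/-- The regularity conditions on the candidate model `k`, with pseudo-true parameter `βs` and
limiting Hessian `H`, when the independent observations `Y i` have the laws `P i`. -/
structure IsRegularModel {𝒴 Ω : Type*} [MeasurableSpace 𝒴] [MeasurableSpace Ω] {p q : ℕ}
    (μ : Measure Ω) (Y : ℕ → Ω → 𝒴) (P : ℕ → Measure 𝒴)
    (f : ℕ → 𝒴 → FullParam p q → ℝ) (B : Set (FullParam p q))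
    (k : Finset (Fin q)) (c : Fin q → ℝ) (βs : SubParam p k)
    (H : Matrix (Fin p ⊕ k) (Fin p ⊕ k) ℝ) : Prop where
  /-- `β*_k` belongs to the parameter space of the candidate model. -/
  mem : βs ∈ subSpace B k c
  /-- The score is square integrable, with bounded average second moment ... -/
  memLp_score : ∀ i, MemLp (fun y => score f k c i y βs) 2 (P i)
  bounded_score : ∃ C : ℝ, ∀ n : ℕ,
    ∑ i ∈ Finset.range n, ∫ y, ‖score f k c i y βs‖ ^ 2 ∂(P i) ≤ C * n
  /-- ... and has mean zero at `β*_k`. -/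
  integral_score : ∀ i, ∫ y, score f k c i y βs ∂(P i) = 0
  /-- The first two derivatives exist near `β*_k`. -/
  differentiable : ∃ r > 0, ∀ i, ∀ᵐ y ∂(P i), ∀ b ∈ Metric.ball βs r,
    DifferentiableAt ℝ (logLik f k c i y) b ∧ DifferentiableAt ℝ (score f k c i y) b
  /-- The second derivative is continuous at `β*_k`, on average uniformly over the observations. -/
  equicontinuous : ∀ η > 0, ∃ r > 0, ∃ G : ℕ → 𝒴 → ℝ,
    (∀ i, Integrable (G i) (P i)) ∧
    (∀ i, ∀ᵐ y ∂(P i), ∀ b ∈ Metric.ball βs r, ∀ a a',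
      |scoreDeriv f k c i y b a a' - scoreDeriv f k c i y βs a a'| ≤ G i y) ∧
    ∀ᶠ n : ℕ in atTop, (n : ℝ)⁻¹ * ∑ i ∈ Finset.range n, ∫ y, G i y ∂(P i) ≤ η
  /-- Near `β*_k` the second derivative is dominated, with bounded moments of some order larger
  than one. -/
  dominated : ∃ r > 0, ∃ δ > 0, ∃ K : ℝ, ∃ D : ℕ → 𝒴 → ℝ, ∀ i,
    (∀ᵐ y ∂(P i), ∀ b ∈ Metric.ball βs r, ∀ a a', |scoreDeriv f k c i y b a a'| ≤ D i y) ∧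
    Integrable (fun y => |D i y| ^ (1 + δ)) (P i) ∧ ∫ y, |D i y| ^ (1 + δ) ∂(P i) ≤ K
  /-- `H = lim (1/n) E ℓ''_k(β*_k)` exists and is invertible. -/
  integrable_scoreDeriv : ∀ i a a', Integrable (fun y => scoreDeriv f k c i y βs a a') (P i)
  tendsto_scoreDeriv : ∀ a a', Tendsto
    (fun n : ℕ => (n : ℝ)⁻¹ * ∑ i ∈ Finset.range n, ∫ y, scoreDeriv f k c i y βs a a' ∂(P i))
    atTop (𝓝 (H a a'))
  isUnit_det : IsUnit H.det
  /-- Identifiability: outside each neighbourhood of `β*_k`, the average log-likelihood lies below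
  its value at `β*_k` by a fixed margin, with probability tending to one. -/
  separated : ∀ ε > 0, ∃ η > 0, Tendsto
    (fun n : ℕ => μ {ω | ∃ b ∈ subSpace B k c, ε ≤ ‖b - βs‖ ∧
      -η < (n : ℝ)⁻¹ * (sampleLogLik f k c n (fun i => Y i ω) b
        - sampleLogLik f k c n (fun i => Y i ω) βs)})
    atTop (𝓝 0)

/-- `[I_p, 0] H⁻¹ ℓ'_{k;i}(b)`. -/
def thetaInfluence {𝒴 : Type*} {p q : ℕ} (f : ℕ → 𝒴 → FullParam p q → ℝ) (k : Finset (Fin q))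
    (c : Fin q → ℝ) (H : Matrix (Fin p ⊕ k) (Fin p ⊕ k) ℝ) (i : ℕ) (y : 𝒴) (b : SubParam p k) :
    EuclideanSpace ℝ (Fin p) :=
  WithLp.toLp 2 (Matrix.mulVec
    (Matrix.fromCols (1 : Matrix (Fin p) (Fin p) ℝ) (0 : Matrix (Fin p) k ℝ) * H⁻¹)
    (fun a => score f k c i y b a))

/-- `max_k ‖[I_p, 0] H_k⁻¹ ℓ'_{k;i}(β*_k)‖`, the maximum over the candidate models. -/
def maxInfluence {𝒴 : Type*} {p q : ℕ} (f : ℕ → 𝒴 → FullParam p q → ℝ)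
    (M : Finset (Finset (Fin q))) (hM : M.Nonempty) (c : Finset (Fin q) → Fin q → ℝ)
    (βs : (k : Finset (Fin q)) → SubParam p k)
    (H : (k : Finset (Fin q)) → Matrix (Fin p ⊕ k) (Fin p ⊕ k) ℝ) (i : ℕ) (y : 𝒴) : ℝ :=
  M.sup' hM fun k => ‖thetaInfluence f k (c k) (H k) i y (βs k)‖

/-- The Lindeberg condition for the influence of the observations on the estimators of `θ`. -/
def LindebergCondition {𝒴 : Type*} [MeasurableSpace 𝒴] {p q : ℕ} (P : ℕ → Measure 𝒴)
    (f : ℕ → 𝒴 → FullParam p q → ℝ)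
    (M : Finset (Finset (Fin q))) (hM : M.Nonempty) (c : Finset (Fin q) → Fin q → ℝ)
    (βs : (k : Finset (Fin q)) → SubParam p k)
    (H : (k : Finset (Fin q)) → Matrix (Fin p ⊕ k) (Fin p ⊕ k) ℝ) : Prop :=
  ∀ ε > 0, Tendsto
    (fun n : ℕ => (n : ℝ)⁻¹ * ∑ i ∈ Finset.range n,
      ∫ y, Set.indicator {y | √(n : ℝ) * ε < maxInfluence f M hM c βs H i y}
        (fun y => maxInfluence f M hM c βs H i y ^ 2) y ∂(P i))
    atTop (𝓝 0)

/-- `∑_k w_k [I_p, 0] H_k⁻¹ ℓ'_{k;i}(β*_k)`. -/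
def averagedInfluence {𝒴 : Type*} {p q : ℕ} (f : ℕ → 𝒴 → FullParam p q → ℝ)
    (M : Finset (Finset (Fin q))) (c : Finset (Fin q) → Fin q → ℝ)
    (βs : (k : Finset (Fin q)) → SubParam p k)
    (H : (k : Finset (Fin q)) → Matrix (Fin p ⊕ k) (Fin p ⊕ k) ℝ)
    (w : Finset (Fin q) → ℝ) (i : ℕ) (y : 𝒴) : EuclideanSpace ℝ (Fin p) :=
  ∑ k ∈ M, w k • thetaInfluence f k (c k) (H k) i y (βs k)

/-- `(1/n) ∑_i E[(∑_k w_k [I_p, 0] H_k⁻¹ ℓ'_{k;i}(β*_k))^{⊗2}]`. -/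
def averageVariance {𝒴 : Type*} [MeasurableSpace 𝒴] {p q : ℕ} (P : ℕ → Measure 𝒴)
    (f : ℕ → 𝒴 → FullParam p q → ℝ)
    (M : Finset (Finset (Fin q))) (c : Finset (Fin q) → Fin q → ℝ)
    (βs : (k : Finset (Fin q)) → SubParam p k)
    (H : (k : Finset (Fin q)) → Matrix (Fin p ⊕ k) (Fin p ⊕ k) ℝ)
    (w : Finset (Fin q) → ℝ) (n : ℕ) : Matrix (Fin p) (Fin p) ℝ :=
  Matrix.of fun a a' => (n : ℝ)⁻¹ * ∑ i ∈ Finset.range n,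
    ∫ y, averagedInfluence f M c βs H w i y a * averagedInfluence f M c βs H w i y a' ∂(P i)

end ModelAveraging

end

/-! Each maximum likelihood estimator is asymptotically linear around its own pseudo-true value:
√n(β̂_k − β*_k) = −H_k⁻¹ n^{-1/2} ∑ᵢ ℓ'_{k;i}(β*_k) + o_P(1). All candidate models use the same
observations, so projecting to θ and averaging with fixed weights gives, up to o_P(1), one
normalized sum of independent centred vectors, the negated averaged influences. A Lindeberg central
limit theorem handles this sum, and Slutsky's theorem transfers the limit to the estimator. The bias
term is exactly what the centring at θ*_k leaves over, and θ_true cancels.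

The expansion (`tendsto_measure_norm_expansion_ge`) rests on three facts. Identifiability gives
consistency. A law of large numbers for uniformly integrable variables gives convergence of the
averaged Hessian at β*_k to H_k, and averaged equicontinuity extends this to a neighbourhood. At an
interior maximum the score vanishes, so the mean value inequality gives a linearized score equation
with error o_P(‖β̂_k − β*_k‖). Since the normalized score is bounded in L², inverting H_k turns that
relative error into o_P(1).

The central limit theorem (`tendstoInDistribution_of_lindeberg`) is proved with characteristic
functions. Because the weights are convex, the averaged influence is dominated by the maximal
influence and inherits its Lindeberg condition. The limit Σ_w may be singular: it is positive
semidefinite as a limit of averaged second moment matrices. -/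

namespace ModelAveraging

/-! ### The Lindeberg central limit theorem via characteristic functions. -/

section Lindeberg

/-- The cubic bound is the Taylor remainder for |x| ≤ 1; the quadratic one is the triangle
inequality for |x| ≥ 1. The quadratic branch serves on the tails, where only second moments are
available, and the cubic branch on the truncated part. -/
lemma norm_cexp_sub_taylor_le (x : ℝ) :
    ‖Complex.exp (x * Complex.I) - (1 + x * Complex.I - (x : ℂ) ^ 2 / 2)‖
      ≤ 4 * min (x ^ 2) (|x| ^ 3) := by
  have hx : ‖(x : ℂ) * Complex.I‖ = |x| := by simp
  rcases le_total |x| 1 with h | h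
  · have := Complex.exp_bound (x := x * Complex.I) (by rw [hx]; exact h) (n := 3) (by norm_num)
    rw [hx] at this
    have e : ∑ m ∈ Finset.range 3, ((x : ℂ) * Complex.I) ^ m / (m.factorial : ℂ)
        = 1 + x * Complex.I - (x : ℂ) ^ 2 / 2 := by
      simp [Finset.sum_range_succ, mul_pow, Nat.factorial]
      ring
    rw [e] at this
    refine this.trans ?_
    have h3 : |x| ^ 3 ≤ x ^ 2 := by
      rw [← sq_abs x]
      exact pow_le_pow_of_le_one (abs_nonneg x) h (by norm_num)
    rw [min_eq_right h3]
    norm_num [Nat.factorial]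
    nlinarith [pow_nonneg (abs_nonneg x) 3]
  · have h3 : x ^ 2 ≤ |x| ^ 3 := by
      rw [← sq_abs x]
      exact pow_le_pow_right₀ h (by norm_num)
    rw [min_eq_left h3]
    calc ‖Complex.exp (x * Complex.I) - (1 + x * Complex.I - (x : ℂ) ^ 2 / 2)‖
        ≤ ‖Complex.exp (x * Complex.I)‖ + ‖(1 + x * Complex.I - (x : ℂ) ^ 2 / 2)‖ := norm_sub_le _ _
      _ ≤ 1 + (‖(1 : ℂ)‖ + ‖(x : ℂ) * Complex.I‖ + ‖(x : ℂ) ^ 2 / 2‖) := by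
          gcongr
          · exact (Complex.norm_exp_ofReal_mul_I x).le
          · exact (norm_sub_le _ _).trans (by gcongr; exact norm_add_le _ _)
      _ = 1 + (1 + |x| + |x| ^ 2 / 2) := by simp
      _ ≤ 4 * x ^ 2 := by
          rw [← sq_abs x]
          nlinarith

/-- Telescoping: the factors are exchanged one at a time, and all the others have norm at most one.
-/
lemma norm_prod_sub_prod_le {ι : Type*} (s : Finset ι) (a b : ι → ℂ)
    (ha : ∀ i, ‖a i‖ ≤ 1) (hb : ∀ i, ‖b i‖ ≤ 1) :
    ‖∏ i ∈ s, a i - ∏ i ∈ s, b i‖ ≤ ∑ i ∈ s, ‖a i - b i‖ := by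
  classical
  induction s using Finset.induction_on with
  | empty => simp
  | insert j s hj ih =>
    rw [Finset.prod_insert hj, Finset.prod_insert hj, Finset.sum_insert hj]
    have e : a j * ∏ i ∈ s, a i - b j * ∏ i ∈ s, b i
        = (a j - b j) * ∏ i ∈ s, a i + b j * (∏ i ∈ s, a i - ∏ i ∈ s, b i) := by ring
    rw [e]
    refine (norm_add_le _ _).trans ?_
    rw [norm_mul, norm_mul]
    have h1 : ‖∏ i ∈ s, a i‖ ≤ 1 := by
      rw [norm_prod]
      exact Finset.prod_le_one (fun _ _ => norm_nonneg _) fun i _ => ha i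
    gcongr
    · exact mul_le_of_le_one_right (norm_nonneg _) h1
    · exact (mul_le_of_le_one_left (norm_nonneg _) (hb j)).trans ih

lemma abs_exp_neg_sub_le {u : ℝ} (hu : 0 ≤ u) : |Real.exp (-u) - (1 - u)| ≤ u ^ 2 := by
  rcases le_total u 1 with h | h
  · have := Real.abs_exp_sub_one_sub_id_le (x := -u) (by rwa [abs_neg, abs_of_nonneg hu])
    calc |Real.exp (-u) - (1 - u)| = |Real.exp (-u) - 1 - -u| := by ring_nf
      _ ≤ _ := this
      _ = _ := by ring
  · have h1 : Real.exp (-u) ≤ 1 := Real.exp_le_one_iff.2 (by linarith)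
    have h2 := Real.exp_pos (-u)
    rw [abs_le]
    constructor <;> nlinarith

variable {Ω : Type*} [MeasurableSpace Ω] {μ : Measure Ω}

lemma integral_inner_sq {ι : Type*} [Fintype ι] [DecidableEq ι] {X : Ω → EuclideanSpace ℝ ι}
    (hX : MemLp X 2 μ) (t : EuclideanSpace ℝ ι) :
    ∫ ω, (inner ℝ (X ω) t) ^ 2 ∂μ = ∑ a, ∑ a', (t a * t a') * ∫ ω, X ω a * X ω a' ∂μ := by
  have hc : ∀ a, MemLp (fun ω => X ω a) 2 μ := fun a => by
    simpa [EuclideanSpace.inner_single_right] using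
      hX.inner_const (𝕜 := ℝ) (EuclideanSpace.single a (1 : ℝ))
  have hint : ∀ a a', Integrable (fun ω => (t a * t a') * (X ω a * X ω a')) μ := fun a a' =>
    ((hc a).integrable_mul (hc a')).const_mul _
  have e : ∀ ω, (inner ℝ (X ω) t) ^ 2 = ∑ a, ∑ a', (t a * t a') * (X ω a * X ω a') := by
    intro ω
    rw [PiLp.inner_apply, sq, Finset.sum_mul_sum]
    refine Finset.sum_congr rfl fun a _ => Finset.sum_congr rfl fun a' _ => ?_
    simp; ring
  simp_rw [e]
  rw [integral_finsetSum _ fun a _ => integrable_finsetSum _ fun a' _ => hint a a']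
  refine Finset.sum_congr rfl fun a _ => ?_
  rw [integral_finsetSum _ fun a' _ => hint a a']
  exact Finset.sum_congr rfl fun a' _ => integral_const_mul _ _

lemma tendsto_average_integral_inner_sq {ι : Type*} [Fintype ι] [DecidableEq ι]
    {X : ℕ → Ω → EuclideanSpace ℝ ι} (hX : ∀ i, MemLp (X i) 2 μ) {S : Matrix ι ι ℝ}
    (hcov : ∀ a a', Tendsto (fun n : ℕ => (n : ℝ)⁻¹ * ∑ i ∈ Finset.range n,
      ∫ ω, X i ω a * X i ω a' ∂μ) atTop (𝓝 (S a a'))) (t : EuclideanSpace ℝ ι) :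
    Tendsto (fun n : ℕ => (n : ℝ)⁻¹ * ∑ i ∈ Finset.range n, ∫ ω, (inner ℝ (X i ω) t) ^ 2 ∂μ) atTop
      (𝓝 (∑ a, ∑ a', (t a * t a') * S a a')) := by
  have e : ∀ n : ℕ, (n : ℝ)⁻¹ * ∑ i ∈ Finset.range n, ∫ ω, (inner ℝ (X i ω) t) ^ 2 ∂μ
      = ∑ a, ∑ a', (t a * t a') *
        ((n : ℝ)⁻¹ * ∑ i ∈ Finset.range n, ∫ ω, X i ω a * X i ω a' ∂μ) := by
    intro n
    rw [Finset.sum_congr rfl fun i _ => integral_inner_sq (hX i) t]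
    rw [Finset.sum_comm, Finset.mul_sum]
    refine Finset.sum_congr rfl fun a _ => ?_
    rw [Finset.sum_comm, Finset.mul_sum]
    refine Finset.sum_congr rfl fun a' _ => ?_
    rw [← Finset.mul_sum]; ring
  simp_rw [e]
  exact tendsto_finsetSum _ fun a _ => tendsto_finsetSum _ fun a' _ => (hcov a a').const_mul _

/-- A limit of averaged second moment matrices is positive semidefinite. -/
lemma posSemidef_of_tendsto_average {ι : Type*} [Fintype ι] [DecidableEq ι]
    {X : ℕ → Ω → EuclideanSpace ℝ ι} (hX : ∀ i, MemLp (X i) 2 μ) {S : Matrix ι ι ℝ}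
    (hcov : ∀ a a', Tendsto (fun n : ℕ => (n : ℝ)⁻¹ * ∑ i ∈ Finset.range n,
      ∫ ω, X i ω a * X i ω a' ∂μ) atTop (𝓝 (S a a'))) : S.PosSemidef := by
  refine Matrix.PosSemidef.of_dotProduct_mulVec_nonneg ?_ fun x => ?_
  · ext a a'
    simp only [Matrix.conjTranspose_apply, star_trivial]
    refine tendsto_nhds_unique (hcov a' a) ?_
    simpa only [mul_comm (_ : ℝ) ((X _ _).ofLp a')] using hcov a a'
  · have h : 0 ≤ ∑ a, ∑ a', (x a * x a') * S a a' :=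
      ge_of_tendsto' (tendsto_average_integral_inner_sq hX hcov (WithLp.toLp 2 x)) fun n => by
        positivity
    have e : dotProduct (star x) (S.mulVec x) = ∑ a, ∑ a', (x a * x a') * S a a' := by
      simp [dotProduct, Matrix.mulVec, Finset.mul_sum, mul_comm, mul_left_comm]
    rw [e]
    exact h

variable [IsProbabilityMeasure μ]

/-- A Lindeberg-type bound for the distance of a characteristic function to that of the Gaussian law
with the same variance. -/
lemma norm_charFun_sub_exp_le {X : Ω → ℝ} (hX : MemLp X 2 μ) (h0 : ∫ ω, X ω ∂μ = 0) (s : ℝ)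
    {a : ℝ} (ha : 0 ≤ a) :
    ‖charFun (μ.map X) s - (Real.exp (-(s ^ 2 * (∫ ω, X ω ^ 2 ∂μ) / 2)) : ℝ)‖ ≤
      4 * (s ^ 2 * (∫ ω, {ω | a < |X ω|}.indicator (fun ω => X ω ^ 2) ω ∂μ)
        + |s| ^ 3 * a * ∫ ω, X ω ^ 2 ∂μ) + (s ^ 2 * (∫ ω, X ω ^ 2 ∂μ) / 2) ^ 2 := by
  have hm := hX.aestronglyMeasurable.aemeasurable
  have hint : Integrable X μ := hX.integrable (by norm_num)
  have hsq : Integrable (fun ω => X ω ^ 2) μ := hX.integrable_sq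
  have hind : Integrable ({ω | a < |X ω|}.indicator fun ω => X ω ^ 2) μ :=
    hsq.indicator₀ (nullMeasurableSet_lt aemeasurable_const hm.abs)
  set v := ∫ ω, X ω ^ 2 ∂μ with hv
  have hv0 : 0 ≤ v := integral_nonneg fun _ => sq_nonneg _
  have e1 : charFun (μ.map X) s = ∫ ω, Complex.exp ((s * X ω : ℝ) * Complex.I) ∂μ := by
    rw [charFun_apply_real, integral_map hm (by fun_prop)]
    simp
  have hexp : Integrable (fun ω => Complex.exp ((s * X ω : ℝ) * Complex.I)) μ := by
    refine Integrable.of_bound (C := 1) (by fun_prop) (ae_of_all _ fun ω => ?_)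
    exact (Complex.norm_exp_ofReal_mul_I _).le
  have i1 : Integrable (fun ω => ((s * X ω : ℝ) : ℂ) * Complex.I) μ :=
    ((hint.const_mul s).ofReal).mul_const _
  have i2 : Integrable (fun ω => ((s * X ω : ℝ) : ℂ) ^ 2 / 2) μ := by
    have : Integrable (fun ω => ((s ^ 2 * X ω ^ 2 : ℝ) : ℂ)) μ := (hsq.const_mul (s ^ 2)).ofReal
    refine (this.div_const 2).congr (ae_of_all _ fun ω => ?_)
    push_cast; ring
  have i3 : Integrable (fun ω => 1 + ((s * X ω : ℝ) : ℂ) * Complex.I) μ :=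
    (integrable_const _).add i1
  have i4 : Integrable (fun ω => 1 + ((s * X ω : ℝ) : ℂ) * Complex.I
      - ((s * X ω : ℝ) : ℂ) ^ 2 / 2) μ := i3.sub i2
  have e2 : ∫ ω, (1 + ((s * X ω : ℝ) : ℂ) * Complex.I - ((s * X ω : ℝ) : ℂ) ^ 2 / 2) ∂μ
      = ((1 - s ^ 2 * v / 2 : ℝ) : ℂ) := by
    rw [integral_sub i3 i2, integral_add (integrable_const _) i1,
      integral_mul_const, integral_complex_ofReal, integral_const_mul, h0]
    have : ∫ ω, ((s * X ω : ℝ) : ℂ) ^ 2 / 2 ∂μ = ((s ^ 2 * v / 2 : ℝ) : ℂ) := by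
      rw [hv, ← integral_const_mul, ← integral_div, ← integral_complex_ofReal]
      refine integral_congr_ae (ae_of_all _ fun ω => ?_)
      push_cast; ring
    rw [this]
    simp
  have step1 : ‖charFun (μ.map X) s - ((1 - s ^ 2 * v / 2 : ℝ) : ℂ)‖ ≤
      4 * (s ^ 2 * (∫ ω, {ω | a < |X ω|}.indicator (fun ω => X ω ^ 2) ω ∂μ) + |s| ^ 3 * a * v) := by
    rw [e1, ← e2, ← integral_sub hexp i4]
    refine (norm_integral_le_integral_norm _).trans ?_
    rw [hv, ← integral_const_mul, ← integral_const_mul, ← integral_add (hind.const_mul _)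
      (hsq.const_mul _), ← integral_const_mul]
    refine integral_mono (hexp.sub i4).norm
      (((hind.const_mul _).add (hsq.const_mul _)).const_mul _) fun ω => ?_
    refine (norm_cexp_sub_taylor_le (s * X ω)).trans ?_
    have h3 : 0 ≤ |s| ^ 3 := by positivity
    -- Above the level `a` the quadratic branch of the minimum is used; below it the cubic branch,
    -- with |X|³ ≤ a X².
    by_cases hω : a < |X ω|
    · have : {ω | a < |X ω|}.indicator (fun ω => X ω ^ 2) ω = X ω ^ 2 :=
        Set.indicator_of_mem (s := {ω | a < |X ω|}) hω _
      simp only [this]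
      gcongr
      refine (min_le_left _ _).trans ?_
      have : 0 ≤ |s| ^ 3 * a * X ω ^ 2 := by positivity
      linarith [mul_pow s (X ω) 2]
    · have : {ω | a < |X ω|}.indicator (fun ω => X ω ^ 2) ω = 0 :=
        Set.indicator_of_notMem (s := {ω | a < |X ω|}) hω _
      simp only [this]
      gcongr
      refine (min_le_right _ _).trans ?_
      rw [abs_mul, mul_pow, mul_zero, zero_add, mul_assoc, ← sq_abs (X ω)]
      gcongr
      rw [pow_succ, mul_comm]
      gcongr
      exact not_lt.1 hω
  have step2 : ‖((1 - s ^ 2 * v / 2 : ℝ) : ℂ) - (Real.exp (-(s ^ 2 * v / 2)) : ℝ)‖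
      ≤ (s ^ 2 * v / 2) ^ 2 := by
    rw [← Complex.ofReal_sub, Complex.norm_real, Real.norm_eq_abs, abs_sub_comm]
    exact abs_exp_neg_sub_le (by positivity)
  exact (norm_sub_le_norm_sub_add_norm_sub _ _ _).trans (add_le_add step1 step2)

/-- With `a` = √n ε this shows that under Lindeberg's condition no single summand contributes a
non-negligible share of the variance. -/
lemma integral_sq_le_add_integral_indicator {X : Ω → ℝ} (hX : MemLp X 2 μ) (a : ℝ) :
    ∫ ω, X ω ^ 2 ∂μ ≤ a ^ 2 + ∫ ω, {ω | a < |X ω|}.indicator (fun ω => X ω ^ 2) ω ∂μ := by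
  have hsq : Integrable (fun ω => X ω ^ 2) μ := hX.integrable_sq
  have hind : Integrable ({ω | a < |X ω|}.indicator fun ω => X ω ^ 2) μ :=
    hsq.indicator₀ (nullMeasurableSet_lt aemeasurable_const
      hX.aestronglyMeasurable.aemeasurable.abs)
  have : a ^ 2 = ∫ _ : Ω, a ^ 2 ∂μ := by simp
  rw [this, ← integral_add (integrable_const _) hind]
  refine integral_mono hsq ((integrable_const _).add hind) fun ω => ?_
  by_cases hω : a < |X ω|
  · simp only [Set.indicator_of_mem (s := {ω | a < |X ω|}) hω]
    nlinarith [sq_nonneg a]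
  · simp only [Set.indicator_of_notMem (s := {ω | a < |X ω|}) hω]
    rw [add_zero, ← sq_abs (X ω)]
    exact pow_le_pow_left₀ (abs_nonneg _) (not_lt.1 hω) 2

/-- Convergence of the characteristic function of `n^{-1/2} ∑ X_i` under Lindeberg's condition. -/
lemma tendsto_prod_charFun_of_lindeberg {X : ℕ → Ω → ℝ} (hX : ∀ i, MemLp (X i) 2 μ)
    (h0 : ∀ i, ∫ ω, X i ω ∂μ = 0) {v : ℝ}
    (hv : Tendsto (fun n : ℕ => (n : ℝ)⁻¹ * ∑ i ∈ Finset.range n, ∫ ω, X i ω ^ 2 ∂μ) atTop (𝓝 v))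
    (hL : ∀ ε > 0, Tendsto (fun n : ℕ => (n : ℝ)⁻¹ * ∑ i ∈ Finset.range n,
      ∫ ω, {ω | √(n : ℝ) * ε < |X i ω|}.indicator (fun ω => X i ω ^ 2) ω ∂μ) atTop (𝓝 0)) :
    Tendsto (fun n : ℕ => ∏ i ∈ Finset.range n, charFun (μ.map (X i)) (√(n : ℝ))⁻¹) atTop
      (𝓝 (Real.exp (-(v / 2)) : ℝ)) := by
  have : ∀ i, IsProbabilityMeasure (μ.map (X i)) := fun i =>
    Measure.isProbabilityMeasure_map (hX i).aestronglyMeasurable.aemeasurable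
  set V : ℕ → ℝ := fun n => (n : ℝ)⁻¹ * ∑ i ∈ Finset.range n, ∫ ω, X i ω ^ 2 ∂μ with hV
  have hgauss : Tendsto (fun n : ℕ => ((Real.exp (-(V n / 2)) : ℝ) : ℂ)) atTop
      (𝓝 (Real.exp (-(v / 2)) : ℝ)) :=
    (Complex.continuous_ofReal.tendsto _).comp
      ((Real.continuous_exp.tendsto _).comp ((hv.div_const 2).neg))
  -- The comparison is with the Gaussian of the actual variance `V n`, because its characteristic
  -- function factors over the same indices.
  suffices h : Tendsto (fun n : ℕ => ∏ i ∈ Finset.range n, charFun (μ.map (X i)) (√(n : ℝ))⁻¹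
      - ((Real.exp (-(V n / 2)) : ℝ) : ℂ)) atTop (𝓝 0) by
    simpa using h.add hgauss
  rw [Metric.tendsto_nhds]
  intro η hη
  have hv0 : 0 ≤ v := ge_of_tendsto' hv fun n => by positivity
  -- This is the limit in n of the final error bound; the zeros stand for the vanishing Lindeberg
  -- sum.
  obtain ⟨ε, hε, hε'⟩ : ∃ ε > 0, 4 * (0 + ε * v) + (ε ^ 2 + 0) * v < η := by
    have : Tendsto (fun ε : ℝ => 4 * (0 + ε * v) + (ε ^ 2 + 0) * v) (𝓝[>] 0)
        (𝓝 (4 * (0 + 0 * v) + (0 ^ 2 + 0) * v)) :=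
      tendsto_nhdsWithin_of_tendsto_nhds (Continuous.tendsto (by fun_prop) 0)
    have h := this.eventually (gt_mem_nhds (by simpa using hη))
    obtain ⟨ε, h1, h2⟩ := (h.and self_mem_nhdsWithin).exists
    exact ⟨ε, h2, h1⟩
  have hlim := ((((hL ε hε).add (hv.const_mul ε)).const_mul 4).add
    (((hL ε hε).const_add (ε ^ 2)).mul hv)).eventually (gt_mem_nhds hε')
  filter_upwards [hlim, eventually_gt_atTop 0] with n hn hn0
  rw [dist_zero_right]
  refine lt_of_le_of_lt ?_ hn
  have hnR : (0 : ℝ) < n := by exact_mod_cast hn0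
  have hs : ((√(n : ℝ))⁻¹) ^ 2 = (n : ℝ)⁻¹ := by rw [inv_pow, Real.sq_sqrt hnR.le]
  set L := (n : ℝ)⁻¹ * ∑ i ∈ Finset.range n,
      ∫ ω, {ω | √(n : ℝ) * ε < |X i ω|}.indicator (fun ω => X i ω ^ 2) ω ∂μ with hLdef
  have hτ0 : ∀ i, 0 ≤ ∫ ω, {ω | √(n : ℝ) * ε < |X i ω|}.indicator (fun ω => X i ω ^ 2) ω ∂μ :=
    fun i => integral_nonneg fun ω => Set.indicator_nonneg (fun _ _ => sq_nonneg _) ω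
  have hv0' : ∀ i, 0 ≤ ∫ ω, X i ω ^ 2 ∂μ := fun i => integral_nonneg fun ω => sq_nonneg _
  have eprod : ((Real.exp (-(V n / 2)) : ℝ) : ℂ) = ∏ i ∈ Finset.range n,
      ((Real.exp (-(((√(n : ℝ))⁻¹) ^ 2 * (∫ ω, X i ω ^ 2 ∂μ) / 2)) : ℝ) : ℂ) := by
    rw [← Complex.ofReal_prod, ← Real.exp_sum]
    congr 2
    rw [Finset.sum_neg_distrib, ← Finset.sum_div, ← Finset.mul_sum, hs]
  rw [eprod]
  refine (norm_prod_sub_prod_le _ _ _ (fun i => norm_charFun_le_one _) fun i => ?_).trans ?_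
  · rw [Complex.norm_real, Real.norm_eq_abs, Real.abs_exp, Real.exp_le_one_iff]
    have := hv0' i
    have : 0 ≤ ((√(n : ℝ))⁻¹) ^ 2 * (∫ ω, X i ω ^ 2 ∂μ) / 2 := by positivity
    linarith
  have hbound : ∀ i ∈ Finset.range n, ‖charFun (μ.map (X i)) (√(n : ℝ))⁻¹ -
      ((Real.exp (-(((√(n : ℝ))⁻¹) ^ 2 * (∫ ω, X i ω ^ 2 ∂μ) / 2)) : ℝ) : ℂ)‖ ≤
      4 * ((n : ℝ)⁻¹ * (∫ ω, {ω | √(n : ℝ) * ε < |X i ω|}.indicator (fun ω => X i ω ^ 2) ω ∂μ)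
        + ε * ((n : ℝ)⁻¹ * ∫ ω, X i ω ^ 2 ∂μ))
        + (ε ^ 2 + L) * ((n : ℝ)⁻¹ * ∫ ω, X i ω ^ 2 ∂μ) := by
    intro i hi
    refine (norm_charFun_sub_exp_le (hX i) (h0 i) _ (a := √(n : ℝ) * ε) (by positivity)).trans ?_
    rw [hs]
    -- The truncation level √n ε turns the cubic error into ε times the share of the variance.
    have h3 : |(√(n : ℝ))⁻¹| ^ 3 * (√(n : ℝ) * ε) = ε * (n : ℝ)⁻¹ := by
      rw [abs_of_nonneg (by positivity), ← hs]
      have : √(n : ℝ) ≠ 0 := (Real.sqrt_pos.2 hnR).ne'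
      field_simp
    rw [h3, mul_assoc ε]
    gcongr
    have hvi := integral_sq_le_add_integral_indicator (hX i) (√(n : ℝ) * ε)
    have hτL : (n : ℝ)⁻¹ * (∫ ω, {ω | √(n : ℝ) * ε < |X i ω|}.indicator
        (fun ω => X i ω ^ 2) ω ∂μ) ≤ L := by
      rw [hLdef]
      gcongr
      exact Finset.single_le_sum (f := fun i => ∫ ω, {ω | √(n : ℝ) * ε < |X i ω|}.indicator
        (fun ω => X i ω ^ 2) ω ∂μ) (fun j _ => hτ0 j) hi
    have hu : (n : ℝ)⁻¹ * (∫ ω, X i ω ^ 2 ∂μ) ≤ ε ^ 2 + L := by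
      calc (n : ℝ)⁻¹ * (∫ ω, X i ω ^ 2 ∂μ) ≤ (n : ℝ)⁻¹ * ((√(n : ℝ) * ε) ^ 2
            + ∫ ω, {ω | √(n : ℝ) * ε < |X i ω|}.indicator (fun ω => X i ω ^ 2) ω ∂μ) := by gcongr
        _ = ε ^ 2 + (n : ℝ)⁻¹ * (∫ ω, {ω | √(n : ℝ) * ε < |X i ω|}.indicator
            (fun ω => X i ω ^ 2) ω ∂μ) := by
            rw [mul_pow, Real.sq_sqrt hnR.le]; field_simp
        _ ≤ _ := by gcongr
    have hu0 : 0 ≤ (n : ℝ)⁻¹ * (∫ ω, X i ω ^ 2 ∂μ) := mul_nonneg (by positivity) (hv0' i)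
    -- Only one factor of the square is bounded by ε² + L; the other is kept, so that summation over
    -- i gives `V n`.
    nlinarith [mul_le_mul_of_nonneg_right hu hu0]
  refine (Finset.sum_le_sum hbound).trans (le_of_eq ?_)
  simp only [Finset.sum_add_distrib, ← Finset.mul_sum]
  rfl

/-- The Lindeberg central limit theorem in `ℝ^ι`. -/
theorem tendstoInDistribution_of_lindeberg {ι : Type*} [Fintype ι] [DecidableEq ι]
    {X : ℕ → Ω → EuclideanSpace ℝ ι} (hind : iIndepFun X μ) (hX : ∀ i, MemLp (X i) 2 μ)
    (h0 : ∀ i, ∫ ω, X i ω ∂μ = 0) {S : Matrix ι ι ℝ}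
    (hcov : ∀ a a', Tendsto (fun n : ℕ => (n : ℝ)⁻¹ * ∑ i ∈ Finset.range n,
      ∫ ω, X i ω a * X i ω a' ∂μ) atTop (𝓝 (S a a')))
    (hL : ∀ ε > 0, Tendsto (fun n : ℕ => (n : ℝ)⁻¹ * ∑ i ∈ Finset.range n,
      ∫ ω, {ω | √(n : ℝ) * ε < ‖X i ω‖}.indicator (fun ω => ‖X i ω‖ ^ 2) ω ∂μ) atTop (𝓝 0)) :
    TendstoInDistribution (fun (n : ℕ) ω => (√(n : ℝ))⁻¹ • ∑ i ∈ Finset.range n, X i ω) atTop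
      (fun z => z) (fun _ => μ) (multivariateGaussian 0 S) := by
  have hS := posSemidef_of_tendsto_average hX hcov
  have hm : ∀ i, AEMeasurable (X i) μ := fun i => (hX i).aestronglyMeasurable.aemeasurable
  have hms : ∀ n : ℕ, AEMeasurable (fun ω => ∑ i ∈ Finset.range n, X i ω) μ :=
    fun n => Finset.aemeasurable_fun_sum _ fun i _ => hm i
  refine ⟨fun n => (hms n).const_smul (√(n : ℝ))⁻¹, by fun_prop, ?_⟩
  refine ProbabilityMeasure.tendsto_iff_tendsto_charFun.2 fun t => ?_
  have hZ : ∀ i, MemLp (fun ω => inner ℝ (X i ω) t) 2 μ := fun i => (hX i).inner_const t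
  -- The Cramér–Wold reduction: in the fixed direction `t` only the real variables ⟨X i, t⟩ matter.
  have hterm : ∀ i (r : ℝ), charFun (μ.map (X i)) (r • t)
      = charFun (μ.map fun ω => inner ℝ (X i ω) t) r := by
    intro i r
    have hmi := (hZ i).aestronglyMeasurable.aemeasurable
    rw [charFun_apply, charFun_apply_real, integral_map (hm i) (by fun_prop),
      integral_map hmi (by fun_prop)]
    simp [inner_smul_right]
  have hlhs : ∀ n : ℕ, charFun (μ.map fun ω => (√(n : ℝ))⁻¹ • ∑ i ∈ Finset.range n, X i ω) t
      = ∏ i ∈ Finset.range n, charFun (μ.map fun ω => inner ℝ (X i ω) t) (√(n : ℝ))⁻¹ := by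
    intro n
    rw [charFun_map_smul_comp (hms n),
      (hind.restrict _).charFun_map_fun_finsetSum_eq_prod fun i _ => hm i, Finset.prod_apply]
    exact Finset.prod_congr rfl fun i _ => hterm i _
  have hvar := tendsto_average_integral_inner_sq hX hcov t
  have hLt : ∀ ε > 0, Tendsto (fun n : ℕ => (n : ℝ)⁻¹ * ∑ i ∈ Finset.range n,
      ∫ ω, {ω | √(n : ℝ) * ε < |inner ℝ (X i ω) t|}.indicator
        (fun ω => (inner ℝ (X i ω) t) ^ 2) ω ∂μ) atTop (𝓝 0) := by
    intro ε hε
    -- Adding one covers the direction t = 0 without a separate case.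
    have ht : 0 < ‖t‖ + 1 := by positivity
    have hlim := (hL (ε / (‖t‖ + 1)) (by positivity)).const_mul ((‖t‖ + 1) ^ 2)
    rw [mul_zero] at hlim
    refine squeeze_zero (fun n => ?_) (fun n => ?_) hlim
    · exact mul_nonneg (by positivity) (Finset.sum_nonneg fun i _ =>
        integral_nonneg fun ω => Set.indicator_nonneg (fun _ _ => sq_nonneg _) ω)
    · rw [mul_left_comm ((‖t‖ + 1) ^ 2)]
      refine mul_le_mul_of_nonneg_left ?_ (by positivity)
      rw [Finset.mul_sum]
      refine Finset.sum_le_sum fun i _ => ?_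
      rw [← integral_const_mul]
      refine integral_mono ?_ ?_ fun ω => ?_
      · exact (hZ i).integrable_sq.indicator₀ (nullMeasurableSet_lt aemeasurable_const
          (hZ i).aestronglyMeasurable.aemeasurable.abs)
      · exact ((hX i).norm.integrable_sq.indicator₀ (nullMeasurableSet_lt aemeasurable_const
          (hm i).norm)).const_mul _
      · have hle : |inner ℝ (X i ω) t| ≤ (‖t‖ + 1) * ‖X i ω‖ := by
          refine (abs_real_inner_le_norm _ _).trans ?_
          nlinarith [norm_nonneg (X i ω)]
        by_cases hω : √(n : ℝ) * ε < |inner ℝ (X i ω) t|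
        · have hω' : √(n : ℝ) * (ε / (‖t‖ + 1)) < ‖X i ω‖ := by
            rw [← mul_div_assoc, div_lt_iff₀ ht, mul_comm ‖X i ω‖]
            exact hω.trans_le hle
          simp only [Set.indicator_of_mem (s := {ω | √(n : ℝ) * ε < |inner ℝ (X i ω) t|}) hω,
            Set.indicator_of_mem (s := {ω | √(n : ℝ) * (ε / (‖t‖ + 1)) < ‖X i ω‖}) hω']
          rw [← sq_abs, ← mul_pow]
          gcongr
        · simp only [Set.indicator_of_notMem (s := {ω | √(n : ℝ) * ε < |inner ℝ (X i ω) t|}) hω]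
          exact mul_nonneg (by positivity) (Set.indicator_nonneg (fun _ _ => sq_nonneg _) ω)
  have hmain := tendsto_prod_charFun_of_lindeberg hZ (fun i => ?_) hvar hLt
  · simp only [ProbabilityMeasure.coe_mk, hlhs, Measure.map_id']
    rw [charFun_multivariateGaussian hS]
    convert hmain using 2
    rw [inner_zero_right, Complex.ofReal_exp]
    congr 1
    simp [dotProduct, Matrix.mulVec, Finset.mul_sum, mul_comm, mul_left_comm]
  · have hi : Integrable (X i) μ := (hX i).integrable (by norm_num)
    have := integral_inner (𝕜 := ℝ) hi t
    simp_rw [real_inner_comm t]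
    rw [this, h0 i, inner_zero_right]

end Lindeberg

/-! ### Convergence in probability and a weak law of large numbers. -/

section LawOfLargeNumbers

variable {Ω : Type*} [MeasurableSpace Ω] {μ : Measure Ω}

lemma tendsto_measure_zero_mono {A B : ℕ → Set Ω} (hB : Tendsto (fun n => μ (B n)) atTop (𝓝 0))
    (h : ∀ᶠ n in atTop, A n ⊆ B n) : Tendsto (fun n => μ (A n)) atTop (𝓝 0) :=
  tendsto_of_tendsto_of_tendsto_of_le_of_le' tendsto_const_nhds hB
    (Eventually.of_forall fun _ => zero_le) (h.mono fun _ hn => measure_mono hn)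

lemma tendsto_measure_zero_union {A B : ℕ → Set Ω} (hA : Tendsto (fun n => μ (A n)) atTop (𝓝 0))
    (hB : Tendsto (fun n => μ (B n)) atTop (𝓝 0)) :
    Tendsto (fun n => μ (A n ∪ B n)) atTop (𝓝 0) :=
  tendsto_of_tendsto_of_tendsto_of_le_of_le tendsto_const_nhds (by simpa using hA.add hB)
    (fun _ => zero_le) fun _ => measure_union_le _ _

lemma tendsto_measure_zero_iUnion {κ : Type*} [Fintype κ] {A : κ → ℕ → Set Ω}
    (hA : ∀ k, Tendsto (fun n => μ (A k n)) atTop (𝓝 0)) :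
    Tendsto (fun n => μ (⋃ k, A k n)) atTop (𝓝 0) :=
  tendsto_of_tendsto_of_tendsto_of_le_of_le tendsto_const_nhds
    (by simpa using tendsto_finsetSum Finset.univ fun k _ => hA k)
    (fun _ => zero_le) fun _ => measure_iUnion_fintype_le _ _

/-- A uniform bound on moments of an order larger than one implies uniform integrability. -/
lemma exists_integral_indicator_abs_le {Z D : ℕ → Ω → ℝ} {δ K : ℝ} (hδ : 0 < δ)
    (hZD : ∀ i, ∀ᵐ ω ∂μ, |Z i ω| ≤ D i ω)
    (hD : ∀ i, Integrable (fun ω => |D i ω| ^ (1 + δ)) μ)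
    (hK : ∀ i, ∫ ω, |D i ω| ^ (1 + δ) ∂μ ≤ K) {η : ℝ} (hη : 0 < η) :
    ∃ τ : ℝ, ∀ i, ∫ ω, {ω | τ < |Z i ω|}.indicator (fun ω => |Z i ω|) ω ∂μ ≤ η := by
  have hlim : Tendsto (fun τ : ℝ => τ ^ (-δ) * K) atTop (𝓝 (0 * K)) :=
    (tendsto_rpow_neg_atTop hδ).mul_const K
  rw [zero_mul] at hlim
  obtain ⟨τ, hτ, hτ0⟩ := ((hlim.eventually (gt_mem_nhds hη)).and (eventually_gt_atTop 0)).exists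
  refine ⟨τ, fun i => ?_⟩
  calc ∫ ω, {ω | τ < |Z i ω|}.indicator (fun ω => |Z i ω|) ω ∂μ
      ≤ ∫ ω, τ ^ (-δ) * |D i ω| ^ (1 + δ) ∂μ := by
        refine integral_mono_of_nonneg (ae_of_all _ fun ω =>
          Set.indicator_nonneg (fun _ _ => abs_nonneg _) ω) ((hD i).const_mul _) ?_
        filter_upwards [hZD i] with ω hω
        by_cases h : τ < |Z i ω|
        · rw [Set.indicator_of_mem (s := {ω | τ < |Z i ω|}) h]
          have hpos : 0 < |Z i ω| := hτ0.trans h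
          -- Beyond the level τ, the factor with negative exponent is at most τ^(-δ), which makes
          -- the tail small uniformly in i.
          calc |Z i ω| = |Z i ω| ^ (-δ) * |Z i ω| ^ (1 + δ) := by
                rw [← Real.rpow_add hpos]; simp
            _ ≤ τ ^ (-δ) * |D i ω| ^ (1 + δ) := by
                refine mul_le_mul ?_ ?_ (by positivity) (by positivity)
                · exact Real.rpow_le_rpow_of_nonpos hτ0 h.le (by linarith)
                · exact Real.rpow_le_rpow hpos.le (hω.trans (le_abs_self _)) (by linarith)
        · rw [Set.indicator_of_notMem (s := {ω | τ < |Z i ω|}) h]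
          positivity
    _ = τ ^ (-δ) * ∫ ω, |D i ω| ^ (1 + δ) ∂μ := integral_const_mul _ _
    _ ≤ τ ^ (-δ) * K := mul_le_mul_of_nonneg_left (hK i) (by positivity)
    _ ≤ η := hτ.le

variable [IsProbabilityMeasure μ]

lemma measure_ge_le_ofReal_integral_div {g : Ω → ℝ} (h0 : 0 ≤ᵐ[μ] g) (hg : Integrable g μ)
    {ε : ℝ} (hε : 0 < ε) : μ {ω | ε ≤ g ω} ≤ ENNReal.ofReal ((∫ ω, g ω ∂μ) / ε) := by
  have h := mul_meas_ge_le_integral_of_nonneg h0 hg ε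
  rw [← ofReal_measureReal]
  refine ENNReal.ofReal_le_ofReal ?_
  rw [le_div_iff₀ hε, mul_comm]
  exact h

lemma tendsto_measure_ge_of_tendsto_integral {g : ℕ → Ω → ℝ} (h0 : ∀ n, 0 ≤ᵐ[μ] g n)
    (hg : ∀ n, Integrable (g n) μ) (h : Tendsto (fun n => ∫ ω, g n ω ∂μ) atTop (𝓝 0))
    {ε : ℝ} (hε : 0 < ε) : Tendsto (fun n => μ {ω | ε ≤ g n ω}) atTop (𝓝 0) := by
  have := ENNReal.tendsto_ofReal (h.div_const ε)
  rw [zero_div, ENNReal.ofReal_zero] at this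
  exact tendsto_of_tendsto_of_tendsto_of_le_of_le tendsto_const_nhds this (fun _ => zero_le)
    fun n => measure_ge_le_ofReal_integral_div (h0 n) (hg n) hε

lemma integral_sq_sum_of_iIndepFun {Z : ℕ → Ω → ℝ} (hind : iIndepFun Z μ)
    (hZ : ∀ i, MemLp (Z i) 2 μ) (h0 : ∀ i, ∫ ω, Z i ω ∂μ = 0) (n : ℕ) :
    ∫ ω, (∑ i ∈ Finset.range n, Z i ω) ^ 2 ∂μ = ∑ i ∈ Finset.range n, ∫ ω, Z i ω ^ 2 ∂μ := by
  have hm : ∀ i, AEMeasurable (Z i) μ := fun i => (hZ i).aestronglyMeasurable.aemeasurable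
  have h := IndepFun.variance_sum (s := Finset.range n) (fun i _ => hZ i)
    fun i _ j _ hij => hind.indepFun hij
  rw [variance_of_integral_eq_zero (Finset.aemeasurable_sum _ fun i _ => hm i)] at h
  · simpa [fun i => variance_of_integral_eq_zero (hm i) (h0 i)] using h
  · simp only [Finset.sum_apply]
    rw [integral_finsetSum _ fun i _ => (hZ i).integrable (by norm_num)]
    simp [h0]

lemma integral_norm_sq_sum_of_iIndepFun {ι : Type*} [Fintype ι] [DecidableEq ι]
    {X : ℕ → Ω → EuclideanSpace ℝ ι} (hind : iIndepFun X μ) (hX : ∀ i, MemLp (X i) 2 μ)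
    (h0 : ∀ i, ∫ ω, X i ω ∂μ = 0) (n : ℕ) :
    ∫ ω, ‖∑ i ∈ Finset.range n, X i ω‖ ^ 2 ∂μ = ∑ i ∈ Finset.range n, ∫ ω, ‖X i ω‖ ^ 2 ∂μ := by
  have hc : ∀ i a, MemLp (fun ω => X i ω a) 2 μ := fun i a => by
    simpa [EuclideanSpace.inner_single_right] using
      (hX i).inner_const (𝕜 := ℝ) (EuclideanSpace.single a (1 : ℝ))
  have hc0 : ∀ i a, ∫ ω, X i ω a ∂μ = 0 := fun i a => by
    have := (EuclideanSpace.proj (𝕜 := ℝ) a).integral_comp_comm ((hX i).integrable (by norm_num))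
    rw [h0 i, map_zero] at this
    exact this
  have hcind : ∀ a, iIndepFun (fun i ω => X i ω a) μ := fun a =>
    hind.comp (fun _ v => v a) fun _ => by fun_prop
  have hl : ∀ ω, ‖∑ i ∈ Finset.range n, X i ω‖ ^ 2 = ∑ a, (∑ i ∈ Finset.range n, X i ω a) ^ 2 :=
    fun ω => by
      rw [EuclideanSpace.real_norm_sq_eq]
      simp only [WithLp.ofLp_sum, Finset.sum_apply]
  have hr : ∀ i, ∫ ω, ‖X i ω‖ ^ 2 ∂μ = ∑ a, ∫ ω, X i ω a ^ 2 ∂μ := fun i => by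
    rw [← integral_finsetSum _ fun a _ => (hc i a).integrable_sq]
    exact integral_congr_ae (ae_of_all _ fun ω => EuclideanSpace.real_norm_sq_eq _)
  calc ∫ ω, ‖∑ i ∈ Finset.range n, X i ω‖ ^ 2 ∂μ
      = ∫ ω, ∑ a, (∑ i ∈ Finset.range n, X i ω a) ^ 2 ∂μ := integral_congr_ae (ae_of_all _ hl)
    _ = ∑ a, ∫ ω, (∑ i ∈ Finset.range n, X i ω a) ^ 2 ∂μ :=
        integral_finsetSum _ fun a _ => (memLp_finsetSum _ fun i _ => hc i a).integrable_sq
    _ = ∑ a, ∑ i ∈ Finset.range n, ∫ ω, X i ω a ^ 2 ∂μ :=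
        Finset.sum_congr rfl fun a _ => integral_sq_sum_of_iIndepFun (hcind a) (fun i => hc i a)
          (fun i => hc0 i a) n
    _ = ∑ i ∈ Finset.range n, ∫ ω, ‖X i ω‖ ^ 2 ∂μ := by
        rw [Finset.sum_comm]
        exact Finset.sum_congr rfl fun i _ => (hr i).symm

/-- The weak law of large numbers, in `L¹`, for independent uniformly integrable variables. -/
theorem tendsto_integral_abs_average_sub {Z : ℕ → Ω → ℝ} (hind : iIndepFun Z μ)
    (hZ : ∀ i, Integrable (Z i) μ)
    (hUI : ∀ η > 0, ∃ τ : ℝ, ∀ i, ∫ ω, {ω | τ < |Z i ω|}.indicator (fun ω => |Z i ω|) ω ∂μ ≤ η) :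
    Tendsto (fun n : ℕ => ∫ ω, |(n : ℝ)⁻¹ * ∑ i ∈ Finset.range n, (Z i ω - ∫ ω', Z i ω' ∂μ)| ∂μ)
      atTop (𝓝 0) := by
  rw [Metric.tendsto_nhds]
  intro η' hη'
  -- The final bound tends to 3η: η from the truncated part and 2η from the tails.
  set η := η' / 4 with hηdef
  have hη : 0 < η := by positivity
  obtain ⟨τ, hτ⟩ := hUI η hη
  set T : ℝ → ℝ := {x | τ < |x|}ᶜ.indicator id with hT
  set R : ℝ → ℝ := {x | τ < |x|}.indicator id with hR
  have hms : MeasurableSet {x : ℝ | τ < |x|} := measurableSet_lt measurable_const (by fun_prop)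
  have hTm : Measurable T := measurable_id.indicator hms.compl
  have hRm : Measurable R := measurable_id.indicator hms
  have hTR : ∀ x, x = T x + R x := fun x => by
    rw [hT, hR, add_comm]
    exact (congrFun (Set.indicator_self_add_compl {x : ℝ | τ < |x|} id) x).symm
  -- The level τ may be negative; then `T` vanishes, and |τ| is still a bound.
  have hTb : ∀ x, |T x| ≤ |τ| := fun x => by
    by_cases hx : τ < |x|
    · have : T x = 0 := Set.indicator_of_notMem (by simpa using hx) _
      simp [this]
    · have : T x = x := Set.indicator_of_mem (s := {x | τ < |x|}ᶜ) (by simpa using hx) _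
      rw [this]
      exact (not_lt.1 hx).trans (le_abs_self τ)
  have hRb : ∀ i ω, |R (Z i ω)| = {ω | τ < |Z i ω|}.indicator (fun ω => |Z i ω|) ω := fun i ω => by
    by_cases hx : τ < |Z i ω|
    · have : R (Z i ω) = Z i ω := Set.indicator_of_mem (s := {x | τ < |x|}) (by simpa using hx) _
      rw [this, Set.indicator_of_mem (s := {ω | τ < |Z i ω|}) hx]
    · have : R (Z i ω) = 0 := Set.indicator_of_notMem (by simpa using hx) _
      rw [this, Set.indicator_of_notMem (s := {ω | τ < |Z i ω|}) hx, abs_zero]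
  have hZm : ∀ i, AEMeasurable (Z i) μ := fun i => (hZ i).aestronglyMeasurable.aemeasurable
  have hWm : ∀ i, AEMeasurable (fun ω => T (Z i ω)) μ := fun i => hTm.comp_aemeasurable (hZm i)
  have hWp : ∀ i, MemLp (fun ω => T (Z i ω)) 2 μ := fun i =>
    MemLp.of_bound (hWm i).aestronglyMeasurable |τ| (ae_of_all _ fun ω => hTb _)
  have hWi : ∀ i, Integrable (fun ω => T (Z i ω)) μ := fun i => (hWp i).integrable (by norm_num)
  have hRi : ∀ i, Integrable (fun ω => R (Z i ω)) μ := fun i =>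
    ((hZ i).sub (hWi i)).congr (ae_of_all _ fun ω => by
      simp only [Pi.sub_apply]; linarith [hTR (Z i ω)])
  set A : ℕ → Ω → ℝ := fun i ω => T (Z i ω) - ∫ ω', T (Z i ω') ∂μ with hA
  set C : ℕ → Ω → ℝ := fun i ω => R (Z i ω) - ∫ ω', R (Z i ω') ∂μ with hC
  have hAp : ∀ i, MemLp (A i) 2 μ := fun i => (hWp i).sub (memLp_const _)
  have hCi : ∀ i, Integrable (C i) μ := fun i => (hRi i).sub (integrable_const _)
  have hA0 : ∀ i, ∫ ω, A i ω ∂μ = 0 := fun i => by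
    simp only [hA]
    rw [integral_sub (hWi i) (integrable_const _)]
    simp
  have hAind : iIndepFun A μ :=
    hind.comp (fun i x => T x - ∫ ω', T (Z i ω') ∂μ) fun i => hTm.sub_const _
  have hAsq : ∀ i, ∫ ω, A i ω ^ 2 ∂μ ≤ τ ^ 2 := fun i => by
    rw [← variance_of_integral_eq_zero (hAp i).aestronglyMeasurable.aemeasurable (hA0 i)]
    refine (variance_sub_const (hWm i).aestronglyMeasurable _).le.trans ?_
    refine (variance_le_expectation_sq (hWm i).aestronglyMeasurable).trans ?_
    have : τ ^ 2 = ∫ _ : Ω, τ ^ 2 ∂μ := by simp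
    rw [this]
    refine integral_mono (hWp i).integrable_sq (integrable_const _) fun ω => ?_
    exact sq_le_sq.2 (hTb _)
  have hC1 : ∀ i, ∫ ω, |C i ω| ∂μ ≤ 2 * η := fun i => by
    have h1 : ∫ ω, |R (Z i ω)| ∂μ ≤ η := by
      simp_rw [hRb]
      exact hτ i
    calc ∫ ω, |C i ω| ∂μ ≤ ∫ ω, (|R (Z i ω)| + |∫ ω', R (Z i ω') ∂μ|) ∂μ :=
          integral_mono (hCi i).abs ((hRi i).abs.add (integrable_const _)) fun ω => abs_sub _ _
      _ = ∫ ω, |R (Z i ω)| ∂μ + |∫ ω', R (Z i ω') ∂μ| := by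
          rw [integral_add (hRi i).abs (integrable_const _)]; simp
      _ ≤ η + η := add_le_add h1 ((abs_integral_le_integral_abs).trans h1)
      _ = 2 * η := by ring
  have hlim : Tendsto (fun n : ℕ => (n : ℝ)⁻¹ * τ ^ 2 / η + η + 2 * η) atTop
      (𝓝 (0 * τ ^ 2 / η + η + 2 * η)) :=
    (((tendsto_inv_atTop_nhds_zero_nat.mul_const _).div_const _).add_const _).add_const _
  have hev := hlim.eventually (gt_mem_nhds (show 0 * τ ^ 2 / η + η + 2 * η < η' by
    rw [zero_mul, zero_div, hηdef]; linarith))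
  filter_upwards [hev, eventually_gt_atTop 0] with n hn hn0
  have hnR : (0 : ℝ) < n := by exact_mod_cast hn0
  rw [dist_zero_right, Real.norm_eq_abs, abs_of_nonneg (integral_nonneg fun ω => abs_nonneg _)]
  refine lt_of_le_of_lt ?_ hn
  have hsumsq : Integrable (fun ω => (∑ i ∈ Finset.range n, A i ω) ^ 2) μ :=
    (memLp_finsetSum _ fun i _ => hAp i).integrable_sq
  -- The inequality |x| ≤ x²/η + η lets the variance of the truncated part, of order τ²/n, control
  -- its L¹ norm; the tails need only first moments.
  have hpt : ∀ ω, |(n : ℝ)⁻¹ * ∑ i ∈ Finset.range n, (Z i ω - ∫ ω', Z i ω' ∂μ)| ≤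
      (((n : ℝ)⁻¹) ^ 2 * (∑ i ∈ Finset.range n, A i ω) ^ 2 / η + η)
        + (n : ℝ)⁻¹ * ∑ i ∈ Finset.range n, |C i ω| := fun ω => by
    have e : ∀ i, Z i ω - ∫ ω', Z i ω' ∂μ = A i ω + C i ω := fun i => by
      have : ∫ ω', Z i ω' ∂μ = ∫ ω', T (Z i ω') ∂μ + ∫ ω', R (Z i ω') ∂μ := by
        rw [← integral_add (hWi i) (hRi i)]
        exact integral_congr_ae (ae_of_all _ fun ω => hTR _)
      simp only [hA, hC]
      linarith [hTR (Z i ω)]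
    simp_rw [e, Finset.sum_add_distrib, mul_add]
    refine (abs_add_le _ _).trans (add_le_add ?_ ?_)
    · set x := (n : ℝ)⁻¹ * ∑ i ∈ Finset.range n, A i ω with hx
      rw [← mul_pow, ← hx, ← sq_abs, ← sub_le_iff_le_add, le_div_iff₀ hη]
      nlinarith [sq_nonneg (|x| - η), abs_nonneg x, sq_nonneg |x|]
    · rw [abs_mul, abs_of_nonneg (by positivity : 0 ≤ (n : ℝ)⁻¹)]
      gcongr
      exact Finset.abs_sum_le_sum_abs _ _
  have hi1 : Integrable (fun ω => ((n : ℝ)⁻¹) ^ 2 * (∑ i ∈ Finset.range n, A i ω) ^ 2 / η + η) μ :=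
    ((hsumsq.const_mul _).div_const _).add (integrable_const _)
  have hi2 : Integrable (fun ω => (n : ℝ)⁻¹ * ∑ i ∈ Finset.range n, |C i ω|) μ :=
    (integrable_finsetSum _ fun i _ => (hCi i).abs).const_mul _
  refine (integral_mono_of_nonneg (ae_of_all _ fun ω => abs_nonneg _) (hi1.add hi2)
    (ae_of_all _ hpt)).trans ?_
  rw [integral_add' hi1 hi2, integral_add ((hsumsq.const_mul _).div_const _) (integrable_const _),
    integral_div, integral_const_mul, integral_const_mul, integral_sq_sum_of_iIndepFun hAind hAp hA0,
    integral_finsetSum _ fun i _ => (hCi i).abs]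
  have hb1 : ∑ i ∈ Finset.range n, ∫ ω, A i ω ^ 2 ∂μ ≤ n * τ ^ 2 :=
    (Finset.sum_le_sum fun i _ => hAsq i).trans (by simp)
  have hb2 : ∑ i ∈ Finset.range n, ∫ ω, |C i ω| ∂μ ≤ n * (2 * η) :=
    (Finset.sum_le_sum fun i _ => hC1 i).trans (by simp)
  have hc1 : ((n : ℝ)⁻¹) ^ 2 * ∑ i ∈ Finset.range n, ∫ ω, A i ω ^ 2 ∂μ ≤ (n : ℝ)⁻¹ * τ ^ 2 := by
    refine (mul_le_mul_of_nonneg_left hb1 (by positivity)).trans (le_of_eq ?_)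
    field_simp
  have hc2 : (n : ℝ)⁻¹ * ∑ i ∈ Finset.range n, ∫ ω, |C i ω| ∂μ ≤ 2 * η := by
    refine (mul_le_mul_of_nonneg_left hb2 (by positivity)).trans (le_of_eq ?_)
    field_simp
  refine add_le_add (add_le_add (div_le_div_of_nonneg_right hc1 hη.le) ?_) hc2
  simp

/-- The weak law of large numbers when the averaged means converge. -/
lemma tendsto_measure_abs_average_sub_ge {Z : ℕ → Ω → ℝ} (hind : iIndepFun Z μ)
    (hZ : ∀ i, Integrable (Z i) μ)
    (hUI : ∀ η > 0, ∃ τ : ℝ, ∀ i, ∫ ω, {ω | τ < |Z i ω|}.indicator (fun ω => |Z i ω|) ω ∂μ ≤ η)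
    {m : ℝ} (hm : Tendsto (fun n : ℕ => (n : ℝ)⁻¹ * ∑ i ∈ Finset.range n, ∫ ω, Z i ω ∂μ)
      atTop (𝓝 m)) {ε : ℝ} (hε : 0 < ε) :
    Tendsto (fun n : ℕ => μ {ω | ε ≤ |(n : ℝ)⁻¹ * (∑ i ∈ Finset.range n, Z i ω) - m|}) atTop
      (𝓝 0) := by
  have h := tendsto_measure_ge_of_tendsto_integral (fun n => ae_of_all _ fun ω => abs_nonneg _)
    (fun n => ((integrable_finsetSum (Finset.range n) fun i _ =>
      (hZ i).sub (integrable_const (∫ ω', Z i ω' ∂μ))).const_mul (n : ℝ)⁻¹).abs)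
    (tendsto_integral_abs_average_sub hind hZ hUI) (half_pos hε)
  refine tendsto_measure_zero_mono h ?_
  filter_upwards [(Metric.tendsto_nhds.1 hm) (ε / 2) (half_pos hε)] with n hn ω hω
  simp only [Set.mem_ofPred_eq, Pi.sub_apply, Finset.sum_sub_distrib, mul_sub] at hω ⊢
  rw [Real.dist_eq] at hn
  have := abs_sub_le ((n : ℝ)⁻¹ * ∑ i ∈ Finset.range n, Z i ω)
    ((n : ℝ)⁻¹ * ∑ i ∈ Finset.range n, ∫ ω, Z i ω ∂μ) m
  linarith

end LawOfLargeNumbers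

/-! ### Inverting a linearized equation, and the score equation near the centre. -/

section Linearization

variable {Ω : Type*} [MeasurableSpace Ω] {μ : Measure Ω} [IsProbabilityMeasure μ]

/-- If `U + L D` is negligible relative to `D`, and `U` is bounded in `L²`, then `D` is
asymptotically equivalent in probability to `-L⁻¹ U`. -/
lemma tendsto_measure_norm_add_inverse_ge {E : Type*} [NormedAddCommGroup E] [NormedSpace ℝ E]
    {U D : ℕ → Ω → E} (L L' : E →L[ℝ] E) (hL' : ∀ x, L' (L x) = x)
    (hlin : ∀ η > 0, Tendsto (fun n => μ {ω | η * ‖D n ω‖ < ‖U n ω + L (D n ω)‖}) atTop (𝓝 0))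
    (hint : ∀ n, Integrable (fun ω => ‖U n ω‖ ^ 2) μ) {C : ℝ}
    (hC : ∀ n, ∫ ω, ‖U n ω‖ ^ 2 ∂μ ≤ C) {ε : ℝ} (hε : 0 < ε) :
    Tendsto (fun n => μ {ω | ε ≤ ‖D n ω + L' (U n ω)‖}) atTop (𝓝 0) := by
  rw [ENNReal.tendsto_nhds_zero]
  intro κ hκ
  have hκ2 : 0 < κ / 2 := ENNReal.half_pos hκ.ne'
  have hlimK : Tendsto (fun K : ℝ => ENNReal.ofReal (C / K ^ 2)) atTop (𝓝 0) := by
    rw [← ENNReal.ofReal_zero]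
    exact ENNReal.tendsto_ofReal (tendsto_const_nhds.div_atTop
      (tendsto_pow_atTop (by norm_num)))
  obtain ⟨K, hK, hK0⟩ := ((ENNReal.tendsto_nhds_zero.1 hlimK _ hκ2).and
    (eventually_gt_atTop 0)).exists
  set M := ‖L'‖ with hM
  have hM0 : 0 ≤ M := norm_nonneg _
  -- The first condition absorbs the error into ‖D‖ and gives ‖D‖ ≤ 2MK when ‖U‖ < K; the second
  -- then makes the error Mη‖D‖ smaller than ε.
  obtain ⟨η, hη, hη1, hη2⟩ : ∃ η > 0, M * η < 1 / 2 ∧ 2 * M ^ 2 * η * K < ε := by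
    have h1 : Tendsto (fun η : ℝ => M * η) (𝓝[>] 0) (𝓝 (M * 0)) :=
      tendsto_nhdsWithin_of_tendsto_nhds (Continuous.tendsto (by fun_prop) 0)
    have h2 : Tendsto (fun η : ℝ => 2 * M ^ 2 * η * K) (𝓝[>] 0) (𝓝 (2 * M ^ 2 * 0 * K)) :=
      tendsto_nhdsWithin_of_tendsto_nhds (Continuous.tendsto (by fun_prop) 0)
    obtain ⟨η, ⟨h3, h4⟩, h5⟩ := (((h1.eventually (gt_mem_nhds (by norm_num : M * 0 < 1 / 2))).and
      (h2.eventually (gt_mem_nhds (by simpa using hε)))).and self_mem_nhdsWithin).exists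
    exact ⟨η, h5, h3, h4⟩
  filter_upwards [ENNReal.tendsto_nhds_zero.1 (hlin η hη) _ hκ2] with n hn
  have hU : μ {ω | K ^ 2 ≤ ‖U n ω‖ ^ 2} ≤ κ / 2 := by
    refine (measure_ge_le_ofReal_integral_div (ae_of_all _ fun ω => sq_nonneg _) (hint n)
      (by positivity)).trans (le_trans ?_ hK)
    exact ENNReal.ofReal_le_ofReal (div_le_div_of_nonneg_right (hC n) (by positivity))
  calc μ {ω | ε ≤ ‖D n ω + L' (U n ω)‖}
      ≤ μ ({ω | η * ‖D n ω‖ < ‖U n ω + L (D n ω)‖} ∪ {ω | K ^ 2 ≤ ‖U n ω‖ ^ 2}) := by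
        refine measure_mono fun ω hω => ?_
        by_contra hcon
        simp only [Set.mem_union, Set.mem_ofPred_eq, not_or, not_lt, not_le] at hcon hω
        obtain ⟨h1, h2⟩ := hcon
        have h3 : ‖U n ω‖ < K := lt_of_pow_lt_pow_left₀ 2 hK0.le h2
        have e : L' (U n ω + L (D n ω)) = D n ω + L' (U n ω) := by
          rw [map_add, hL', add_comm]
        have h4 : ‖D n ω + L' (U n ω)‖ ≤ M * (η * ‖D n ω‖) := by
          rw [← e]
          exact (L'.le_opNorm _).trans (mul_le_mul_of_nonneg_left h1 hM0)
        have h5 : ‖L' (U n ω)‖ ≤ M * ‖U n ω‖ := L'.le_opNorm _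
        have h6 : ‖D n ω‖ ≤ ‖D n ω + L' (U n ω)‖ + ‖L' (U n ω)‖ := by
          simpa using norm_sub_le (D n ω + L' (U n ω)) (L' (U n ω))
        have hd : 0 ≤ ‖D n ω‖ := norm_nonneg _
        have h7 : ‖D n ω‖ ≤ 2 * (M * K) := by
          have : M * ‖U n ω‖ ≤ M * K := mul_le_mul_of_nonneg_left h3.le hM0
          nlinarith
        have h8 : M * (η * ‖D n ω‖) ≤ M * (η * (2 * (M * K))) := by gcongr
        nlinarith
    _ ≤ κ / 2 + κ / 2 := (measure_union_le _ _).trans (add_le_add hn hU)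
    _ = κ := ENNReal.add_halves κ

variable {ι : Type*} [Fintype ι] [DecidableEq ι]

/-- A crude ℓ¹ estimate, sufficient because the dimension is fixed: it turns entrywise control of
Hessians into operator norm control. -/
lemma opNorm_le_of_abs_entry_le (T : EuclideanSpace ℝ ι →L[ℝ] EuclideanSpace ℝ ι) {c : ℝ}
    (hc : 0 ≤ c) (hT : ∀ a a', |T (EuclideanSpace.single a' 1) a| ≤ c) :
    ‖T‖ ≤ (Fintype.card ι : ℝ) ^ 2 * c := by
  have hl1 : ∀ v : EuclideanSpace ℝ ι, ‖v‖ ≤ ∑ a, |v a| := fun v => by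
    conv_lhs => rw [← (EuclideanSpace.basisFun ι ℝ).sum_repr v]
    refine (norm_sum_le _ _).trans (le_of_eq ?_)
    simp [norm_smul]
  refine T.opNorm_le_bound (by positivity) fun v => ?_
  conv_lhs => rw [← (EuclideanSpace.basisFun ι ℝ).sum_repr v]
  rw [map_sum]
  refine (norm_sum_le _ _).trans ?_
  have : ∀ a' ∈ Finset.univ, ‖T ((EuclideanSpace.basisFun ι ℝ).repr v a'
      • EuclideanSpace.basisFun ι ℝ a')‖ ≤ ‖v‖ * (Fintype.card ι * c) := fun a' _ => by
    rw [map_smul, norm_smul]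
    gcongr
    · simpa using PiLp.norm_apply_le v a'
    · refine (hl1 _).trans ((Finset.sum_le_sum fun a _ => ?_).trans (?_ : ∑ _a : ι, c ≤ _))
      · simpa using hT a a'
      · simp
  refine (Finset.sum_le_sum this).trans (le_of_eq ?_)
  simp
  ring

/-- The score equation linearized at `b₀`, for a sum of functions with controlled second
derivatives. -/
lemma norm_average_gradient_add_le {n : ℕ} (hn : 0 < n) (F : ℕ → EuclideanSpace ℝ ι → ℝ)
    (H : Matrix ι ι ℝ) (g : ℕ → ℝ) {b₀ b : EuclideanSpace ℝ ι} {r η : ℝ}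
    (hb : b ∈ Metric.ball b₀ r)
    (hF : ∀ i, ∀ x ∈ Metric.ball b₀ r, DifferentiableAt ℝ (F i) x)
    (hF' : ∀ i, ∀ x ∈ Metric.ball b₀ r, DifferentiableAt ℝ (gradient (F i)) x)
    (hg : ∀ i, ∀ x ∈ Metric.ball b₀ r, ∀ a a',
      |fderiv ℝ (gradient (F i)) x (EuclideanSpace.single a' 1) a
        - fderiv ℝ (gradient (F i)) b₀ (EuclideanSpace.single a' 1) a| ≤ g i)
    (hmax : IsLocalMax (fun x => ∑ i ∈ Finset.range n, F i x) b)
    (hH : ∀ a a', |(n : ℝ)⁻¹ * (∑ i ∈ Finset.range n,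
      fderiv ℝ (gradient (F i)) b₀ (EuclideanSpace.single a' 1) a) - H a a'| ≤ η)
    (hgη : (n : ℝ)⁻¹ * ∑ i ∈ Finset.range n, g i ≤ η) (hη : 0 ≤ η) :
    ‖(n : ℝ)⁻¹ • ∑ i ∈ Finset.range n, gradient (F i) b₀
      + Matrix.toEuclideanCLM (𝕜 := ℝ) H (b - b₀)‖
      ≤ (Fintype.card ι : ℝ) ^ 2 * (2 * η) * ‖b - b₀‖ := by
  set Φ : EuclideanSpace ℝ ι → EuclideanSpace ℝ ι :=
    fun x => (n : ℝ)⁻¹ • ∑ i ∈ Finset.range n, gradient (F i) x with hΦ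
  have hr : 0 < r := dist_nonneg.trans_lt hb
  have hΦd : ∀ x ∈ Metric.ball b₀ r, HasFDerivAt Φ
      ((n : ℝ)⁻¹ • ∑ i ∈ Finset.range n, fderiv ℝ (gradient (F i)) x) x := fun x hx =>
    (HasFDerivAt.fun_sum fun i _ => (hF' i x hx).hasFDerivAt).const_smul (n : ℝ)⁻¹
  have hΦb : Φ b = 0 := by
    have h1 : HasFDerivAt (fun x => ∑ i ∈ Finset.range n, F i x)
        (∑ i ∈ Finset.range n, fderiv ℝ (F i) b) b :=
      HasFDerivAt.fun_sum fun i _ => (hF i b hb).hasFDerivAt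
    have h2 := hmax.hasFDerivAt_eq_zero h1
    have h3 : ∑ i ∈ Finset.range n, gradient (F i) b = 0 := by
      have : InnerProductSpace.toDual ℝ _ (∑ i ∈ Finset.range n, gradient (F i) b) = 0 := by
        rw [map_sum, ← h2]
        exact Finset.sum_congr rfl fun i _ => toDual_gradient
      exact (map_eq_zero_iff _ (LinearIsometryEquiv.injective _)).1 this
    simp only [hΦ]
    rw [h3, smul_zero]
  -- One η comes from the variation of the second derivatives over the ball, the other from their
  -- average at `b₀`.
  have hbound : ∀ x ∈ Metric.ball b₀ r,
      ‖fderiv ℝ Φ x - Matrix.toEuclideanCLM (𝕜 := ℝ) H‖ ≤ (Fintype.card ι : ℝ) ^ 2 * (2 * η) := by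
    intro x hx
    refine opNorm_le_of_abs_entry_le _ (by positivity) fun a a' => ?_
    rw [(hΦd x hx).fderiv]
    have e : (((n : ℝ)⁻¹ • ∑ i ∈ Finset.range n, fderiv ℝ (gradient (F i)) x)
        - Matrix.toEuclideanCLM (𝕜 := ℝ) H) (EuclideanSpace.single a' 1) a
        = (n : ℝ)⁻¹ * (∑ i ∈ Finset.range n,
          (fderiv ℝ (gradient (F i)) x (EuclideanSpace.single a' 1) a
            - fderiv ℝ (gradient (F i)) b₀ (EuclideanSpace.single a' 1) a))
          + ((n : ℝ)⁻¹ * (∑ i ∈ Finset.range n,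
            fderiv ℝ (gradient (F i)) b₀ (EuclideanSpace.single a' 1) a) - H a a') := by
      simp [Finset.sum_sub_distrib]
      ring
    rw [e]
    refine (abs_add_le _ _).trans ?_
    rw [two_mul]
    refine add_le_add ?_ (hH a a')
    rw [abs_mul, abs_of_nonneg (by positivity : 0 ≤ (n : ℝ)⁻¹)]
    refine le_trans ?_ hgη
    gcongr
    exact (Finset.abs_sum_le_sum_abs _ _).trans (Finset.sum_le_sum fun i _ => hg i x hx a a')
  -- The mean value inequality for Φ minus the linear map `H` replaces an intermediate point, which
  -- need not exist for vector-valued maps.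
  have hmv := (convex_ball b₀ r).norm_image_sub_le_of_norm_fderiv_le'
    (fun x hx => (hΦd x hx).differentiableAt) hbound (Metric.mem_ball_self hr) hb
  rw [hΦb, zero_sub, ← norm_neg] at hmv
  rw [neg_sub, sub_neg_eq_add, add_comm] at hmv
  exact hmv

end Linearization

/-! ### Consistency and asymptotic linearity of the estimator in one candidate model. -/

section CandidateModel

variable {𝒴 Ω : Type*} [MeasurableSpace 𝒴] [MeasurableSpace Ω] {p q : ℕ}

lemma continuous_augment (k : Finset (Fin q)) (c : Fin q → ℝ) :
    Continuous (augment (p := p) (k := k) c) := by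
  unfold augment
  refine (PiLp.continuous_toLp 2 _).comp (continuous_pi fun j => ?_)
  rcases j with j | j
  · simp only [Sum.elim_inl]
    fun_prop
  · simp only [Sum.elim_inr]
    split_ifs <;> fun_prop

/-- Openness makes a maximizer over the parameter space a local maximum, so that the score equation
holds there. -/
lemma isOpen_subSpace {B : Set (FullParam p q)} (hB : IsOpen B) (k : Finset (Fin q))
    (c : Fin q → ℝ) : IsOpen (subSpace B k c) :=
  hB.preimage (continuous_augment k c)

variable {μ : Measure Ω} {Y : ℕ → Ω → 𝒴} {P : ℕ → Measure 𝒴}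
  {f : ℕ → 𝒴 → FullParam p q → ℝ} {B : Set (FullParam p q)} {k : Finset (Fin q)} {c : Fin q → ℝ}
  {βs : SubParam p k} {H : Matrix (Fin p ⊕ k) (Fin p ⊕ k) ℝ} {b : ℕ → Ω → SubParam p k}

/-- Consistency of the maximum likelihood estimator for the pseudo-true parameter. -/
lemma IsRegularModel.tendsto_measure_norm_sub_ge (hreg : IsRegularModel μ Y P f B k c βs H)
    (hb : Tendsto (fun n : ℕ => μ {ω | ¬ IsMLE f B k c n (fun i => Y i ω) (b n ω)}) atTop (𝓝 0))
    {ε : ℝ} (hε : 0 < ε) : Tendsto (fun n => μ {ω | ε ≤ ‖b n ω - βs‖}) atTop (𝓝 0) := by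
  obtain ⟨η, hη, h⟩ := hreg.separated ε hε
  refine tendsto_measure_zero_mono (tendsto_measure_zero_union hb h)
    (Eventually.of_forall fun n ω hω => ?_)
  by_cases hM : IsMLE f B k c n (fun i => Y i ω) (b n ω)
  -- A maximizer does at least as well as `βs`, so a distant one itself violates the identifiability
  -- margin.
  · refine Or.inr ⟨b n ω, hM.1, hω, ?_⟩
    have : 0 ≤ (n : ℝ)⁻¹ * (sampleLogLik f k c n (fun i => Y i ω) (b n ω)
        - sampleLogLik f k c n (fun i => Y i ω) βs) :=
      mul_nonneg (by positivity) (sub_nonneg.2 (hM.2 βs hreg.mem))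
    linarith
  · exact Or.inl hM

/-- This and the next three lemmas carry conditions stated under the laws `P i` over to the
probability space of the observations. -/
lemma _root_.ProbabilityTheory.HasLaw.ae_comp {Q : Measure 𝒴} {Z : Ω → 𝒴} (h : HasLaw Z Q μ)
    {r : 𝒴 → Prop} (hr : ∀ᵐ y ∂Q, r y) : ∀ᵐ ω ∂μ, r (Z ω) :=
  ae_of_ae_map h.aemeasurable (by rwa [h.map_eq])

lemma _root_.ProbabilityTheory.HasLaw.memLp_comp {E : Type*} [NormedAddCommGroup E] {Q : Measure 𝒴}
    {Z : Ω → 𝒴} (h : HasLaw Z Q μ) {g : 𝒴 → E} {s : ENNReal} (hg : MemLp g s Q) :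
    MemLp (fun ω => g (Z ω)) s μ :=
  MemLp.comp_of_map (by rwa [h.map_eq]) h.aemeasurable

lemma _root_.ProbabilityTheory.HasLaw.integrable_comp {E : Type*} [NormedAddCommGroup E]
    {Q : Measure 𝒴} {Z : Ω → 𝒴} (h : HasLaw Z Q μ) {g : 𝒴 → E} (hg : Integrable g Q) :
    Integrable (fun ω => g (Z ω)) μ :=
  memLp_one_iff_integrable.1 (h.memLp_comp (memLp_one_iff_integrable.2 hg))

lemma _root_.ProbabilityTheory.iIndepFun.comp_hasLaw {E : Type*} [MeasurableSpace E]
    (hY : iIndepFun Y μ) (hYlaw : ∀ i, HasLaw (Y i) (P i) μ) (g : ℕ → 𝒴 → E)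
    (hg : ∀ i, AEMeasurable (g i) (P i)) : iIndepFun (fun i ω => g i (Y i ω)) μ :=
  hY.comp₀ g (fun i => (hYlaw i).aemeasurable) fun i => by rw [(hYlaw i).map_eq]; exact hg i

variable [IsProbabilityMeasure μ]

/-- The law of large numbers for the second derivatives of the log-likelihood. -/
lemma IsRegularModel.tendsto_measure_scoreDeriv (hreg : IsRegularModel μ Y P f B k c βs H)
    (hY : iIndepFun Y μ) (hYlaw : ∀ i, HasLaw (Y i) (P i) μ) (a a' : Fin p ⊕ k) {ε : ℝ}
    (hε : 0 < ε) :
    Tendsto (fun n : ℕ => μ {ω | ε ≤ |(n : ℝ)⁻¹ * (∑ i ∈ Finset.range n,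
      scoreDeriv f k c i (Y i ω) βs a a') - H a a'|}) atTop (𝓝 0) := by
  have hint := fun i => hreg.integrable_scoreDeriv i a a'
  obtain ⟨r, hr, δ, hδ, K, D, hD⟩ := hreg.dominated
  refine tendsto_measure_abs_average_sub_ge
    (hY.comp_hasLaw hYlaw (fun i y => scoreDeriv f k c i y βs a a')
      fun i => (hint i).aestronglyMeasurable.aemeasurable)
    (fun i => (hYlaw i).integrable_comp (hint i)) (fun η hη => ?_) ?_ hε
  -- In `dominated` the exponent `δ` is a natural number, whereas the tail estimate takes a real
  -- exponent.
  · have hpow : ∀ i y, |D i y| ^ (1 + (δ : ℝ)) = |D i y| ^ (1 + δ) := fun i y => by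
      rw [← Real.rpow_natCast]
      push_cast
      rfl
    refine exists_integral_indicator_abs_le (δ := δ) (D := fun i ω => D i (Y i ω))
      (by exact_mod_cast hδ) (fun i => ?_) (fun i => ?_) (fun i => ?_) hη (K := K)
    · exact (hYlaw i).ae_comp ((hD i).1.mono fun y hy => hy βs (Metric.mem_ball_self hr) a a')
    · simp only [hpow]
      exact (hYlaw i).integrable_comp (hD i).2.1
    · simp only [hpow]
      exact ((hYlaw i).integral_comp (hD i).2.1.aestronglyMeasurable).trans_le (hD i).2.2
  · refine (hreg.tendsto_scoreDeriv a a').congr fun n => ?_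
    congr 1
    refine Finset.sum_congr rfl fun i _ => ?_
    exact ((hYlaw i).integral_comp (hint i).aestronglyMeasurable).symm

/-- The linearized score equation holds up to an error of smaller order than the estimation
error. -/
lemma IsRegularModel.tendsto_measure_lt_norm_score_add
    (hreg : IsRegularModel μ Y P f B k c βs H) (hB : IsOpen B)
    (hY : iIndepFun Y μ) (hYlaw : ∀ i, HasLaw (Y i) (P i) μ)
    (hb : Tendsto (fun n : ℕ => μ {ω | ¬ IsMLE f B k c n (fun i => Y i ω) (b n ω)}) atTop (𝓝 0))
    {η : ℝ} (hη : 0 < η) :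
    Tendsto (fun n : ℕ => μ {ω | η * ‖√(n : ℝ) • (b n ω - βs)‖ <
      ‖(√(n : ℝ))⁻¹ • ∑ i ∈ Finset.range n, score f k c i (Y i ω) βs
        + Matrix.toEuclideanCLM (𝕜 := ℝ) H (√(n : ℝ) • (b n ω - βs))‖}) atTop (𝓝 0) := by
  -- Without coordinates both sides are zero; otherwise an entry of the Hessian exists and forces
  -- `G` to be nonnegative.
  rcases isEmpty_or_nonempty (Fin p ⊕ k) with hemp | hne
  · have : ∀ x : SubParam p k, ‖x‖ = 0 := fun x => by rw [Subsingleton.elim x 0, norm_zero]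
    simp [this]
  set N : ℝ := (Fintype.card (Fin p ⊕ k) : ℝ) ^ 2 with hN
  have hN0 : 0 ≤ N := by positivity
  -- Chosen so that the constant N · 2θ of `norm_average_gradient_add_le` is at most η.
  set θ : ℝ := η / (2 * N + 1) with hθ
  have hθ0 : 0 < θ := by positivity
  have hNθ : N * (2 * θ) ≤ η := by
    rw [hθ, ← mul_div_assoc, ← mul_div_assoc, div_le_iff₀ (by positivity)]
    nlinarith
  rw [ENNReal.tendsto_nhds_zero]
  intro κ hκ
  have hκ2 : 0 < κ / 2 := ENNReal.half_pos hκ.ne'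
  -- By Markov's inequality, a mean at most ρ gives the averaged `G` probability at most κ/2 of
  -- reaching θ. The radius then depends on κ, which is harmless since consistency holds at every
  -- radius.
  obtain ⟨ρ, hρκ, hρ⟩ : ∃ ρ : ℝ, ENNReal.ofReal (ρ / θ) ≤ κ / 2 ∧ 0 < ρ := by
    have h1 : Tendsto (fun ρ : ℝ => ENNReal.ofReal (ρ / θ)) (𝓝[>] 0) (𝓝 (ENNReal.ofReal (0 / θ))) :=
      tendsto_nhdsWithin_of_tendsto_nhds
        (ENNReal.tendsto_ofReal (Continuous.tendsto (by fun_prop) 0))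
    rw [zero_div, ENNReal.ofReal_zero] at h1
    exact ((ENNReal.tendsto_nhds_zero.1 h1 _ hκ2).and self_mem_nhdsWithin).exists
  obtain ⟨r₁, hr₁, hdiff⟩ := hreg.differentiable
  obtain ⟨r₂, hr₂, G, hGi, hG, hGρ⟩ := hreg.equicontinuous ρ hρ
  set r := min r₁ r₂ with hr
  have hr0 : 0 < r := lt_min hr₁ hr₂
  have hae : ∀ᵐ ω ∂μ, ∀ i,
      (∀ x ∈ Metric.ball βs r₁, DifferentiableAt ℝ (logLik f k c i (Y i ω)) x ∧
        DifferentiableAt ℝ (score f k c i (Y i ω)) x) ∧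
      (∀ x ∈ Metric.ball βs r₂, ∀ a a', |scoreDeriv f k c i (Y i ω) x a a'
        - scoreDeriv f k c i (Y i ω) βs a a'| ≤ G i (Y i ω)) :=
    ae_all_iff.2 fun i => ((hYlaw i).ae_comp (hdiff i)).and ((hYlaw i).ae_comp (hG i))
  have hG0 : ∀ᵐ ω ∂μ, ∀ i, 0 ≤ G i (Y i ω) := by
    filter_upwards [hae] with ω hω i
    obtain ⟨a⟩ := hne
    exact (abs_nonneg _).trans ((hω i).2 βs (Metric.mem_ball_self hr₂) a a)
  have hGm : ∀ᶠ n : ℕ in atTop,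
      μ {ω | θ ≤ (n : ℝ)⁻¹ * ∑ i ∈ Finset.range n, G i (Y i ω)} ≤ κ / 2 := by
    filter_upwards [hGρ] with n hn
    have hGi' := fun i => (hYlaw i).integrable_comp (hGi i)
    refine (measure_ge_le_ofReal_integral_div ?_ ((integrable_finsetSum _ fun i _ =>
      hGi' i).const_mul _) hθ0).trans (le_trans (ENNReal.ofReal_le_ofReal ?_) hρκ)
    · filter_upwards [hG0] with ω hω
      exact mul_nonneg (by positivity) (Finset.sum_nonneg fun i _ => hω i)
    · gcongr
      rw [integral_const_mul, integral_finsetSum _ fun i _ => hGi' i]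
      refine le_trans (le_of_eq ?_) hn
      congr 1
      exact Finset.sum_congr rfl fun i _ =>
        (hYlaw i).integral_comp (hGi i).aestronglyMeasurable
  set bad : ℕ → Set Ω := fun n => ({ω | ¬ IsMLE f B k c n (fun i => Y i ω) (b n ω)} ∪
    {ω | r ≤ ‖b n ω - βs‖}) ∪ ⋃ aa : (Fin p ⊕ k) × (Fin p ⊕ k),
      {ω | θ ≤ |(n : ℝ)⁻¹ * (∑ i ∈ Finset.range n, scoreDeriv f k c i (Y i ω) βs aa.1 aa.2)
        - H aa.1 aa.2|} with hbad
  have hbad0 : Tendsto (fun n => μ (bad n)) atTop (𝓝 0) :=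
    tendsto_measure_zero_union
      (tendsto_measure_zero_union hb (hreg.tendsto_measure_norm_sub_ge hb hr0))
      (tendsto_measure_zero_iUnion fun aa =>
        hreg.tendsto_measure_scoreDeriv hY hYlaw aa.1 aa.2 hθ0)
  filter_upwards [hGm, ENNReal.tendsto_nhds_zero.1 hbad0 _ hκ2, eventually_gt_atTop 0]
    with n hn1 hn2 hn0
  refine le_trans (measure_mono_ae (t := bad n ∪
    {ω | θ ≤ (n : ℝ)⁻¹ * ∑ i ∈ Finset.range n, G i (Y i ω)}) ?_)
    ((measure_union_le _ _).trans ((add_le_add hn2 hn1).trans (ENNReal.add_halves κ).le))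
  filter_upwards [hae] with ω hω hlt
  change ω ∈ bad n ∪ {ω | θ ≤ (n : ℝ)⁻¹ * ∑ i ∈ Finset.range n, G i (Y i ω)}
  by_contra hcon
  simp only [hbad, Set.mem_union, Set.mem_iUnion, Set.mem_ofPred_eq, not_or, not_not, not_exists,
    not_le] at hcon
  obtain ⟨⟨⟨hM, hball⟩, hHess⟩, hGω⟩ := hcon
  have hmem : b n ω ∈ Metric.ball βs r := by rwa [mem_ball_iff_norm]
  have hlocal : IsLocalMax (fun x => ∑ i ∈ Finset.range n, logLik f k c i (Y i ω) x) (b n ω) := by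
    filter_upwards [(isOpen_subSpace hB k c).mem_nhds hM.1] with x hx
    exact hM.2 x hx
  have key := norm_average_gradient_add_le hn0 (fun i => logLik f k c i (Y i ω)) H
    (fun i => G i (Y i ω)) hmem
    (fun i x hx => ((hω i).1 x (Metric.ball_subset_ball (min_le_left _ _) hx)).1)
    (fun i x hx => ((hω i).1 x (Metric.ball_subset_ball (min_le_left _ _) hx)).2)
    (fun i x hx a a' => (hω i).2 x (Metric.ball_subset_ball (min_le_right _ _) hx) a a')
    hlocal (fun a a' => (hHess (a, a')).le) hGω.le hθ0.le
  have hnR : (0 : ℝ) < n := by exact_mod_cast hn0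
  have hsq : 0 < √(n : ℝ) := Real.sqrt_pos.2 hnR
  -- The linearized equation is homogeneous, so multiplication by √n passes from averages to the
  -- normalized sum.
  have e : (√(n : ℝ))⁻¹ • ∑ i ∈ Finset.range n, score f k c i (Y i ω) βs
      + Matrix.toEuclideanCLM (𝕜 := ℝ) H (√(n : ℝ) • (b n ω - βs))
      = √(n : ℝ) • ((n : ℝ)⁻¹ • ∑ i ∈ Finset.range n, gradient (logLik f k c i (Y i ω)) βs
        + Matrix.toEuclideanCLM (𝕜 := ℝ) H (b n ω - βs)) := by
    rw [map_smul, smul_add, smul_smul]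
    congr 2
    rw [inv_eq_iff_eq_inv, mul_inv, inv_inv, ← div_eq_inv_mul, Real.div_sqrt]
  have hlt' : η * ‖√(n : ℝ) • (b n ω - βs)‖ <
      ‖(√(n : ℝ))⁻¹ • ∑ i ∈ Finset.range n, score f k c i (Y i ω) βs
        + Matrix.toEuclideanCLM (𝕜 := ℝ) H (√(n : ℝ) • (b n ω - βs))‖ := hlt
  rw [e, norm_smul, norm_smul, Real.norm_of_nonneg hsq.le, mul_left_comm] at hlt'
  have h1 := lt_of_mul_lt_mul_left hlt' hsq.le
  have h2 : N * (2 * θ) * ‖b n ω - βs‖ ≤ η * ‖b n ω - βs‖ := by gcongr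
  linarith

/-- The asymptotic expansion of the maximum likelihood estimator in a candidate model. -/
lemma IsRegularModel.tendsto_measure_norm_expansion_ge
    (hreg : IsRegularModel μ Y P f B k c βs H) (hB : IsOpen B)
    (hY : iIndepFun Y μ) (hYlaw : ∀ i, HasLaw (Y i) (P i) μ)
    (hb : Tendsto (fun n : ℕ => μ {ω | ¬ IsMLE f B k c n (fun i => Y i ω) (b n ω)}) atTop (𝓝 0))
    {ε : ℝ} (hε : 0 < ε) :
    Tendsto (fun n : ℕ => μ {ω | ε ≤ ‖√(n : ℝ) • (b n ω - βs) +
      Matrix.toEuclideanCLM (𝕜 := ℝ) H⁻¹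
        ((√(n : ℝ))⁻¹ • ∑ i ∈ Finset.range n, score f k c i (Y i ω) βs)‖}) atTop (𝓝 0) := by
  have hs : ∀ i, MemLp (fun ω => score f k c i (Y i ω) βs) 2 μ := fun i =>
    (hYlaw i).memLp_comp (hreg.memLp_score i)
  have hsum : ∀ n : ℕ, MemLp (fun ω => (√(n : ℝ))⁻¹ • ∑ i ∈ Finset.range n,
      score f k c i (Y i ω) βs) 2 μ := fun n =>
    (memLp_finsetSum _ fun i _ => hs i).const_smul (√(n : ℝ))⁻¹
  obtain ⟨C, hC⟩ := hreg.bounded_score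
  have hsecond : ∀ n : ℕ, ∫ ω, ‖∑ i ∈ Finset.range n, score f k c i (Y i ω) βs‖ ^ 2 ∂μ
      = ∑ i ∈ Finset.range n, ∫ y, ‖score f k c i y βs‖ ^ 2 ∂(P i) := fun n => by
    rw [integral_norm_sq_sum_of_iIndepFun (hY.comp_hasLaw hYlaw (fun i y => score f k c i y βs)
      fun i => (hreg.memLp_score i).aestronglyMeasurable.aemeasurable) hs fun i => ?_]
    · exact Finset.sum_congr rfl fun i _ =>
        (hYlaw i).integral_comp (hreg.memLp_score i).norm.integrable_sq.aestronglyMeasurable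
    · exact ((hYlaw i).integral_comp (hreg.memLp_score i).aestronglyMeasurable).trans
        (hreg.integral_score i)
  -- The absolute value makes the second moment bound immediate at n = 0 too, where the normalized
  -- sum is zero.
  refine tendsto_measure_norm_add_inverse_ge (C := |C|) (Matrix.toEuclideanCLM (𝕜 := ℝ) H) _
    (fun x => ?_)
    (fun η hη => hreg.tendsto_measure_lt_norm_score_add hB hY hYlaw hb hη)
    (fun n => (hsum n).norm.integrable_sq) (fun n => ?_) hε
  · rw [← mul_apply_eq_comp, ← map_mul, Matrix.nonsing_inv_mul _ hreg.isUnit_det,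
      map_one, one_apply_eq_self]
  · simp_rw [norm_smul, mul_pow]
    rw [integral_const_mul, hsecond, Real.norm_eq_abs, sq_abs, inv_pow,
      Real.sq_sqrt (Nat.cast_nonneg n)]
    rcases Nat.eq_zero_or_pos n with rfl | hn
    · simp
    · have hnR : (0 : ℝ) < n := by exact_mod_cast hn
      rw [inv_mul_le_iff₀ hnR, mul_comm]
      exact (hC n).trans (by gcongr; exact le_abs_self C)

end CandidateModel

/-! ### From single models to the weighted average. -/

section ModelAverage

variable {p q : ℕ}

/-- The projection `(θ, γ) ↦ θ` as a continuous linear map. -/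
noncomputable def thetaProj (p : ℕ) (κ : Type*) [Fintype κ] :
    EuclideanSpace ℝ (Fin p ⊕ κ) →L[ℝ] EuclideanSpace ℝ (Fin p) :=
  LinearMap.toContinuousLinearMap
    { toFun := thetaPart
      map_add' := fun _ _ => rfl
      map_smul' := fun _ _ => rfl }

lemma thetaProj_apply {κ : Type*} [Fintype κ] (b : EuclideanSpace ℝ (Fin p ⊕ κ)) :
    thetaProj p κ b = thetaPart b := rfl

lemma norm_thetaProj_le {κ : Type*} [Fintype κ] (b : EuclideanSpace ℝ (Fin p ⊕ κ)) :
    ‖thetaProj p κ b‖ ≤ ‖b‖ := by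
  refine le_of_sq_le_sq ?_ (norm_nonneg _)
  rw [EuclideanSpace.real_norm_sq_eq, EuclideanSpace.real_norm_sq_eq, Fintype.sum_sum_type]
  exact le_add_of_nonneg_right (Finset.sum_nonneg fun _ _ => sq_nonneg _)

/-- Written as a continuous linear image of the score, the influence inherits square integrability
and mean zero, and it commutes with sums over observations. -/
lemma thetaInfluence_eq {𝒴 : Type*} (f : ℕ → 𝒴 → FullParam p q → ℝ) (k : Finset (Fin q)) (c : Fin q → ℝ)
    (H : Matrix (Fin p ⊕ k) (Fin p ⊕ k) ℝ) (i : ℕ) (y : 𝒴) (b : SubParam p k) :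
    thetaInfluence f k c H i y b
      = thetaProj p k (Matrix.toEuclideanCLM (𝕜 := ℝ) H⁻¹ (score f k c i y b)) := by
  ext j
  simp only [thetaInfluence, ← Matrix.mulVec_mulVec, Matrix.fromCols_mulVec, Matrix.one_mulVec,
    Matrix.zero_mulVec, add_zero]
  rfl

/-- A convex combination cannot exceed the largest of its terms in norm; this is where nonnegativity
and total mass one of the weights enter. -/
lemma norm_averagedInfluence_le_maxInfluence {𝒴 : Type*}
    {f : ℕ → 𝒴 → FullParam p q → ℝ} {M : Finset (Finset (Fin q))}
    {c : Finset (Fin q) → Fin q → ℝ} {βs : (k : Finset (Fin q)) → SubParam p k}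
    {H : (k : Finset (Fin q)) → Matrix (Fin p ⊕ k) (Fin p ⊕ k) ℝ} {w : Finset (Fin q) → ℝ}
    (hM : M.Nonempty) (hw : ∀ k ∈ M, 0 ≤ w k)
    (hw1 : ∑ k ∈ M, w k = 1) (i : ℕ) (y : 𝒴) :
    ‖averagedInfluence f M c βs H w i y‖ ≤ maxInfluence f M hM c βs H i y := by
  calc ‖averagedInfluence f M c βs H w i y‖
      ≤ ∑ k ∈ M, w k * ‖thetaInfluence f k (c k) (H k) i y (βs k)‖ := by
        refine (norm_sum_le _ _).trans (Finset.sum_le_sum fun k hk => ?_)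
        rw [norm_smul, Real.norm_of_nonneg (hw k hk)]
    _ ≤ ∑ k ∈ M, w k * maxInfluence f M hM c βs H i y :=
        Finset.sum_le_sum fun k hk => mul_le_mul_of_nonneg_left
          (Finset.le_sup' (fun k => ‖thetaInfluence f k (c k) (H k) i y (βs k)‖) hk) (hw k hk)
    _ = maxInfluence f M hM c βs H i y := by rw [← Finset.sum_mul, hw1, one_mul]

variable {𝒴 Ω : Type*} [MeasurableSpace 𝒴] [MeasurableSpace Ω]
  {μ : Measure Ω} {Y : ℕ → Ω → 𝒴} {P : ℕ → Measure 𝒴}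
  {f : ℕ → 𝒴 → FullParam p q → ℝ} {B : Set (FullParam p q)}
  {M : Finset (Finset (Fin q))} {c : Finset (Fin q) → Fin q → ℝ}
  {βs : (k : Finset (Fin q)) → SubParam p k}
  {H : (k : Finset (Fin q)) → Matrix (Fin p ⊕ k) (Fin p ⊕ k) ℝ} {w : Finset (Fin q) → ℝ}

lemma IsRegularModel.memLp_thetaInfluence {k : Finset (Fin q)} {c : Fin q → ℝ} {βs : SubParam p k}
    {H : Matrix (Fin p ⊕ k) (Fin p ⊕ k) ℝ} (hreg : IsRegularModel μ Y P f B k c βs H) (i : ℕ) :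
    MemLp (fun y => thetaInfluence f k c H i y βs) 2 (P i) := by
  simp only [thetaInfluence_eq]
  exact ((thetaProj p k).comp (Matrix.toEuclideanCLM (𝕜 := ℝ) H⁻¹)).comp_memLp'
    (hreg.memLp_score i)

lemma IsRegularModel.integral_thetaInfluence {k : Finset (Fin q)} {c : Fin q → ℝ}
    {βs : SubParam p k} {H : Matrix (Fin p ⊕ k) (Fin p ⊕ k) ℝ}
    (hreg : IsRegularModel μ Y P f B k c βs H) (i : ℕ) [IsFiniteMeasure (P i)] :
    ∫ y, thetaInfluence f k c H i y βs ∂(P i) = 0 := by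
  simp only [thetaInfluence_eq]
  have := ((thetaProj p k).comp (Matrix.toEuclideanCLM (𝕜 := ℝ) H⁻¹)).integral_comp_comm
    ((hreg.memLp_score i).integrable (by norm_num))
  rw [hreg.integral_score i, map_zero] at this
  exact this

lemma memLp_averagedInfluence
    (hreg : ∀ k ∈ M, IsRegularModel μ Y P f B k (c k) (βs k) (H k)) (i : ℕ) :
    MemLp (averagedInfluence f M c βs H w i) 2 (P i) :=
  memLp_finsetSum _ fun k hk => ((hreg k hk).memLp_thetaInfluence i).const_smul (w k)

lemma integral_averagedInfluence
    (hreg : ∀ k ∈ M, IsRegularModel μ Y P f B k (c k) (βs k) (H k)) (i : ℕ)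
    [IsFiniteMeasure (P i)] :
    ∫ y, averagedInfluence f M c βs H w i y ∂(P i) = 0 := by
  simp only [averagedInfluence]
  have hint : ∀ k ∈ M, Integrable
      (fun y => w k • thetaInfluence f k (c k) (H k) i y (βs k)) (P i) := fun k hk =>
    (((hreg k hk).memLp_thetaInfluence i).const_smul (w k)).integrable (by norm_num)
  rw [integral_finsetSum _ hint]
  refine Finset.sum_eq_zero fun k hk => ?_
  rw [integral_smul, (hreg k hk).integral_thetaInfluence i, smul_zero]

/-- Needed for domination: the integral of a non-integrable function is zero by convention, so the
Lindeberg condition bounds something only once its integrands are known to be integrable. -/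
lemma memLp_maxInfluence (hM : M.Nonempty)
    (hreg : ∀ k ∈ M, IsRegularModel μ Y P f B k (c k) (βs k) (H k)) (i : ℕ) :
    MemLp (maxInfluence f M hM c βs H i) 2 (P i) := by
  have h : MemLp (M.sup' hM fun k y => ‖thetaInfluence f k (c k) (H k) i y (βs k)‖) 2 (P i) :=
    Finset.sup'_induction hM _ (p := fun g => MemLp g 2 (P i)) (fun _ h₁ _ h₂ => h₁.sup h₂)
      fun k hk => ((hreg k hk).memLp_thetaInfluence i).norm
  refine h.ae_eq (ae_of_all _ fun y => ?_)
  rw [Finset.sup'_apply]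
  rfl

/-- The Lindeberg condition for the averaged influences follows from that for their maximum. -/
lemma LindebergCondition.tendsto_averagedInfluence {hM : M.Nonempty}
    (hL : LindebergCondition P f M hM c βs H)
    (hreg : ∀ k ∈ M, IsRegularModel μ Y P f B k (c k) (βs k) (H k))
    (hw : ∀ k ∈ M, 0 ≤ w k) (hw1 : ∑ k ∈ M, w k = 1) {ε : ℝ} (hε : 0 < ε) :
    Tendsto (fun n : ℕ => (n : ℝ)⁻¹ * ∑ i ∈ Finset.range n,
      ∫ y, {y | √(n : ℝ) * ε < ‖averagedInfluence f M c βs H w i y‖}.indicator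
        (fun y => ‖averagedInfluence f M c βs H w i y‖ ^ 2) y ∂(P i)) atTop (𝓝 0) := by
  refine squeeze_zero (fun n => ?_) (fun n => ?_) (hL ε hε)
  · exact mul_nonneg (by positivity) (Finset.sum_nonneg fun i _ =>
      integral_nonneg fun y => Set.indicator_nonneg (fun _ _ => sq_nonneg _) y)
  · refine mul_le_mul_of_nonneg_left (Finset.sum_le_sum fun i _ => ?_) (by positivity)
    have hU := memLp_maxInfluence hM hreg i
    refine integral_mono_of_nonneg
      (ae_of_all _ fun y => Set.indicator_nonneg (fun _ _ => sq_nonneg _) y)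
      (hU.integrable_sq.indicator₀ (nullMeasurableSet_lt aemeasurable_const
        hU.aestronglyMeasurable.aemeasurable)) (ae_of_all _ fun y => ?_)
    have hle := norm_averagedInfluence_le_maxInfluence (f := f) (c := c) (βs := βs) (H := H)
      hM hw hw1 i y
    by_cases hy : √(n : ℝ) * ε < ‖averagedInfluence f M c βs H w i y‖
    · have hy' : √(n : ℝ) * ε < maxInfluence f M hM c βs H i y := hy.trans_le hle
      simp only [Set.indicator_of_mem
          (s := {y | √(n : ℝ) * ε < ‖averagedInfluence f M c βs H w i y‖}) hy,
        Set.indicator_of_mem (s := {y | √(n : ℝ) * ε < maxInfluence f M hM c βs H i y}) hy']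
      gcongr
    · simp only [Set.indicator_of_notMem
        (s := {y | √(n : ℝ) * ε < ‖averagedInfluence f M c βs H w i y‖}) hy]
      exact Set.indicator_nonneg (fun _ _ => sq_nonneg _) y

variable [IsProbabilityMeasure μ]

/-- The averaged influences satisfy the central limit theorem, and their limiting variance is
positive semidefinite. -/
lemma tendstoInDistribution_averagedInfluence {hM : M.Nonempty}
    (hY : iIndepFun Y μ) (hYlaw : ∀ i, HasLaw (Y i) (P i) μ)
    (hreg : ∀ k ∈ M, IsRegularModel μ Y P f B k (c k) (βs k) (H k))
    (hL : LindebergCondition P f M hM c βs H)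
    (hw : ∀ k ∈ M, 0 ≤ w k) (hw1 : ∑ k ∈ M, w k = 1) {S : Matrix (Fin p) (Fin p) ℝ}
    (hS : Tendsto (averageVariance P f M c βs H w) atTop (𝓝 S)) :
    S.PosSemidef ∧ TendstoInDistribution (fun (n : ℕ) ω => (√(n : ℝ))⁻¹ • ∑ i ∈ Finset.range n,
      -averagedInfluence f M c βs H w i (Y i ω)) atTop (fun z => z) (fun _ => μ)
      (multivariateGaussian 0 S) := by
  have hP : ∀ i, IsProbabilityMeasure (P i) := fun i => by
    rw [← (hYlaw i).map_eq]
    exact Measure.isProbabilityMeasure_map (hYlaw i).aemeasurable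
  have hp := fun i => (memLp_averagedInfluence (w := w) hreg i)
  have hcoord : ∀ i a, MemLp (fun y => averagedInfluence f M c βs H w i y a) 2 (P i) :=
    fun i a => by
      simpa [EuclideanSpace.inner_single_right] using
        (hp i).inner_const (𝕜 := ℝ) (EuclideanSpace.single a (1 : ℝ))
  have hXp : ∀ i, MemLp (fun ω => -averagedInfluence f M c βs H w i (Y i ω)) 2 μ := fun i =>
    ((hYlaw i).memLp_comp (hp i)).neg
  have hX0 : ∀ i, ∫ ω, -averagedInfluence f M c βs H w i (Y i ω) ∂μ = 0 := fun i => by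
    rw [integral_neg, neg_eq_zero]
    exact ((hYlaw i).integral_comp (hp i).aestronglyMeasurable).trans
      (integral_averagedInfluence hreg i)
  -- The minus sign comes from the expansion with −H⁻¹; second moments do not see it.
  have hcov : ∀ a a', Tendsto (fun n : ℕ => (n : ℝ)⁻¹ * ∑ i ∈ Finset.range n,
      ∫ ω, (-averagedInfluence f M c βs H w i (Y i ω)) a
        * (-averagedInfluence f M c βs H w i (Y i ω)) a' ∂μ) atTop (𝓝 (S a a')) := by
    intro a a'
    have h := tendsto_pi_nhds.1 (tendsto_pi_nhds.1 hS a) a'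
    refine h.congr fun n => ?_
    simp only [averageVariance, Matrix.of_apply, PiLp.neg_apply, neg_mul_neg]
    congr 1
    exact Finset.sum_congr rfl fun i _ => ((hYlaw i).integral_comp
      ((hcoord i a).integrable_mul (hcoord i a')).aestronglyMeasurable).symm
  have hLX : ∀ ε > 0, Tendsto (fun n : ℕ => (n : ℝ)⁻¹ * ∑ i ∈ Finset.range n,
      ∫ ω, {ω | √(n : ℝ) * ε < ‖-averagedInfluence f M c βs H w i (Y i ω)‖}.indicator
        (fun ω => ‖-averagedInfluence f M c βs H w i (Y i ω)‖ ^ 2) ω ∂μ) atTop (𝓝 0) := by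
    intro ε hε
    refine (hL.tendsto_averagedInfluence hreg hw hw1 hε).congr fun n => ?_
    simp only [norm_neg]
    congr 1
    exact Finset.sum_congr rfl fun i _ => ((hYlaw i).integral_comp
      ((hp i).norm.integrable_sq.indicator₀ (nullMeasurableSet_lt aemeasurable_const
        (hp i).norm.aestronglyMeasurable.aemeasurable)).aestronglyMeasurable).symm
  have hind : iIndepFun (fun i ω => -averagedInfluence f M c βs H w i (Y i ω)) μ :=
    hY.comp_hasLaw hYlaw (fun i y => -averagedInfluence f M c βs H w i y) fun i =>
      (hp i).neg.aestronglyMeasurable.aemeasurable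
  exact ⟨posSemidef_of_tendsto_average hXp hcov,
    tendstoInDistribution_of_lindeberg hind hXp hX0 hcov hLX⟩

/-- The model averaged estimator is asymptotically equivalent to the sum of the averaged
influences. -/
lemma tendstoInMeasure_modelAverage_sub {b : (k : Finset (Fin q)) → ℕ → Ω → SubParam p k}
    (hB : IsOpen B) (hY : iIndepFun Y μ) (hYlaw : ∀ i, HasLaw (Y i) (P i) μ)
    (hreg : ∀ k ∈ M, IsRegularModel μ Y P f B k (c k) (βs k) (H k))
    (hb : ∀ k ∈ M, Tendsto
      (fun n : ℕ => μ {ω | ¬ IsMLE f B k (c k) n (fun i => Y i ω) (b k n ω)}) atTop (𝓝 0))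
    (θ : EuclideanSpace ℝ (Fin p)) :
    TendstoInMeasure μ ((fun (n : ℕ) (ω : Ω) =>
        √(n : ℝ) • ∑ k ∈ M, w k • (thetaPart (b k n ω) - θ)
          - √(n : ℝ) • ∑ k ∈ M, w k • (thetaPart (βs k) - θ))
        - fun (n : ℕ) ω => (√(n : ℝ))⁻¹ • ∑ i ∈ Finset.range n,
          -averagedInfluence f M c βs H w i (Y i ω)) atTop 0 := by
  set R : (k : Finset (Fin q)) → ℕ → Ω → SubParam p k := fun k n ω =>
    √(n : ℝ) • (b k n ω - βs k) + Matrix.toEuclideanCLM (𝕜 := ℝ) (H k)⁻¹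
      ((√(n : ℝ))⁻¹ • ∑ i ∈ Finset.range n, score f k (c k) i (Y i ω) (βs k)) with hR
  -- An exact identity: the difference is the weighted sum of the projected remainders of the single
  -- models, and `θ` cancels.
  have e : ∀ (n : ℕ) ω, (√(n : ℝ) • ∑ k ∈ M, w k • (thetaPart (b k n ω) - θ)
      - √(n : ℝ) • ∑ k ∈ M, w k • (thetaPart (βs k) - θ))
      - (√(n : ℝ))⁻¹ • ∑ i ∈ Finset.range n, -averagedInfluence f M c βs H w i (Y i ω)
      = ∑ k ∈ M, w k • thetaProj p k (R k n ω) := by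
    intro n ω
    have h1 : √(n : ℝ) • ∑ k ∈ M, w k • (thetaPart (b k n ω) - θ)
        - √(n : ℝ) • ∑ k ∈ M, w k • (thetaPart (βs k) - θ)
        = ∑ k ∈ M, w k • thetaProj p k (√(n : ℝ) • (b k n ω - βs k)) := by
      rw [← smul_sub, ← Finset.sum_sub_distrib, Finset.smul_sum]
      refine Finset.sum_congr rfl fun k _ => ?_
      rw [← smul_sub, sub_sub_sub_cancel_right, smul_comm, map_smul, map_sub, thetaProj_apply,
        thetaProj_apply]
    have h2 : (√(n : ℝ))⁻¹ • ∑ i ∈ Finset.range n, -averagedInfluence f M c βs H w i (Y i ω)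
        = -∑ k ∈ M, w k • thetaProj p k (Matrix.toEuclideanCLM (𝕜 := ℝ) (H k)⁻¹
          ((√(n : ℝ))⁻¹ • ∑ i ∈ Finset.range n, score f k (c k) i (Y i ω) (βs k))) := by
      simp only [averagedInfluence, thetaInfluence_eq]
      rw [Finset.sum_neg_distrib, smul_neg, Finset.sum_comm, Finset.smul_sum]
      congr 1
      refine Finset.sum_congr rfl fun k _ => ?_
      rw [← Finset.smul_sum, smul_comm, map_smul, map_smul, map_sum, map_sum]
    rw [h1, h2, sub_neg_eq_add, ← Finset.sum_add_distrib]
    refine Finset.sum_congr rfl fun k _ => ?_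
    rw [← smul_add, ← map_add]
  rw [tendstoInMeasure_iff_norm]
  intro ε hε
  -- The added one keeps `W` positive and makes the final estimate strict.
  set W : ℝ := ∑ k ∈ M, |w k| + 1 with hW
  have hW0 : 0 < W := by positivity
  have h := tendsto_measure_zero_iUnion (μ := μ) (κ := M)
    (A := fun k n => {ω | ε / W ≤ ‖R k n ω‖}) fun k =>
      (hreg k k.2).tendsto_measure_norm_expansion_ge hB hY hYlaw (hb k k.2)
        (ε := ε / W) (by positivity)
  refine tendsto_measure_zero_mono h (Eventually.of_forall fun n ω hω => ?_)
  by_contra hcon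
  simp only [Set.mem_iUnion, Set.mem_ofPred_eq, not_exists, not_le] at hcon
  have hω' : ε ≤ ‖∑ k ∈ M, w k • thetaProj p k (R k n ω)‖ := by
    rw [← e]
    simpa using hω
  have hlt : ‖∑ k ∈ M, w k • thetaProj p k (R k n ω)‖ < ε := by
    calc ‖∑ k ∈ M, w k • thetaProj p k (R k n ω)‖
        ≤ ∑ k ∈ M, |w k| * (ε / W) := by
          refine (norm_sum_le _ _).trans (Finset.sum_le_sum fun k hk => ?_)
          rw [norm_smul, Real.norm_eq_abs]
          gcongr
          exact (norm_thetaProj_le _).trans (hcon ⟨k, hk⟩).le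
      _ = (W - 1) * (ε / W) := by rw [← Finset.sum_mul, hW, add_sub_cancel_right]
      _ < W * (ε / W) := by
          have : 0 < ε / W := by positivity
          nlinarith
      _ = ε := mul_div_cancel₀ _ hW0.ne'
  exact absurd hω' (not_le.2 hlt)

end ModelAverage

end ModelAveraging

/-! ### The limit law of the model averaged estimator. -/

theorem corollary1
    {𝒴 Ω : Type*} [MeasurableSpace 𝒴] [MeasurableSpace Ω] {p q : ℕ}
    -- the parametric family of densities, with respect to a dominating measure
    (ν : Measure 𝒴) [SigmaFinite ν]
    (f : ℕ → 𝒴 → ModelAveraging.FullParam p q → ℝ) (B : Set (ModelAveraging.FullParam p q))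
    (hf : ModelAveraging.IsDensityFamily ν f B)
    -- the true parameter and the independent observations
    (βtrue : ModelAveraging.FullParam p q) (hβtrue : βtrue ∈ B)
    (μ : Measure Ω) [IsProbabilityMeasure μ] (Y : ℕ → Ω → 𝒴)
    (hY : iIndepFun Y μ)
    (hYlaw : ∀ i, HasLaw (Y i) (ModelAveraging.obsLaw ν f βtrue i) μ)
    -- the candidate models, with their augmentation values and weights
    (M : Finset (Finset (Fin q))) (hM : M.Nonempty)
    (c : Finset (Fin q) → Fin q → ℝ)
    (w : Finset (Fin q) → ℝ) (hw : ∀ k ∈ M, 0 ≤ w k ∧ w k ≤ 1) (hw1 : ∑ k ∈ M, w k = 1)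
    -- the pseudo-true parameters, the limiting Hessians and the regularity conditions
    (βstar : (k : Finset (Fin q)) → ModelAveraging.SubParam p k)
    (H : (k : Finset (Fin q)) → Matrix (Fin p ⊕ k) (Fin p ⊕ k) ℝ)
    (hreg : ∀ k ∈ M, ModelAveraging.IsRegularModel μ Y (ModelAveraging.obsLaw ν f βtrue)
      f B k (c k) (βstar k) (H k))
    (hA1 : ModelAveraging.LindebergCondition (ModelAveraging.obsLaw ν f βtrue) f M hM c βstar H)
    -- the maximum likelihood estimators of the candidate models
    (βhat : (k : Finset (Fin q)) → ℕ → Ω → ModelAveraging.SubParam p k)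
    (hβhat_meas : ∀ k ∈ M, ∀ n, AEMeasurable (βhat k n) μ)
    (hβhat : ∀ k ∈ M, Tendsto
      (fun n : ℕ => μ {ω | ¬ ModelAveraging.IsMLE f B k (c k) n (fun i => Y i ω) (βhat k n ω)})
      atTop (𝓝 0))
    -- the limiting variance
    (Sw : Matrix (Fin p) (Fin p) ℝ)
    (hSw : Tendsto
      (ModelAveraging.averageVariance (ModelAveraging.obsLaw ν f βtrue) f M c βstar H w)
      atTop (𝓝 Sw)) :
    Sw.PosSemidef ∧
    TendstoInDistribution
      (fun (n : ℕ) (ω : Ω) =>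
        √(n : ℝ) • ∑ k ∈ M, w k •
            (ModelAveraging.thetaPart (βhat k n ω) - ModelAveraging.thetaPart βtrue)
          - √(n : ℝ) • ∑ k ∈ M, w k •
            (ModelAveraging.thetaPart (βstar k) - ModelAveraging.thetaPart βtrue))
      atTop (fun z : EuclideanSpace ℝ (Fin p) => z) (fun _ => μ)
      (multivariateGaussian 0 Sw) := by
  obtain ⟨hPSD, hCLT⟩ := ModelAveraging.tendstoInDistribution_averagedInfluence hY hYlaw hreg hA1
    (fun k hk => (hw k hk).1) hw1 hSw
  -- Slutsky's theorem; what remains is the measurability of the averaged estimators.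
  refine ⟨hPSD, tendstoInDistribution_of_tendstoInMeasure_sub _ _ hCLT
    (ModelAveraging.tendstoInMeasure_modelAverage_sub hf.isOpen hY hYlaw hreg hβhat _) fun n => ?_⟩
  refine AEMeasurable.sub_const (AEMeasurable.const_smul (Finset.aemeasurable_fun_sum _
    fun k hk => ?_) (√(n : ℝ))) _
  exact (((ModelAveraging.thetaProj p k).continuous.measurable.comp_aemeasurable
    (hβhat_meas k hk n)).sub_const _).const_smul (w k)
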